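/- Let $\mathcal H_1,\mathcal H_2$ be separable complex Hilbert spaces with inner products linear in the first variable, $U$ and $V$ unitary operators on $\mathcal H_1$ and $\mathcal H_2$, and let $a\in\mathcal H_1$, $b\in\mathcal H_2$ be such that $\{U^na\}_{n\in\mathbb Z}$ and $\{V^mb\}_{m\in\mathbb Z}$ are Riesz sequences (Riesz bases of their closed linear spans). Let $\mathcal H_1\otimes\mathcal H_2$ be the Hilbert space tensor product and $\mathcal A_{a,b}$ the closed linear span of $\{U^na\otimes V^mb\}_{n,m\in\mathbb Z}$ in it. Let $r,\bar r\ge 1$ be integers, $h_{j1}\in\mathcal H_1$ ($j=1,\dots,s$), $h_{j'2}\in\mathcal H_2$ ($j'=1,\dots,s'$), and for $x\in\mathcal A_{a,b}$ and $n,m\in\mathbb Z$ put \[ \mathcal L_{jj'}x(rn,\bar rm)=\big\langle x,\;U^{rn}h_{j1}\otimes V^{\bar rm}h_{j'2}\big\rangle . \] Let $g_{j1},g_{j'2}\in L^2(0,1)$ be the $1$-periodic functions \[ g_{j1}(x)=\sum_{k\in\mathbb Z}\langle a,U^kh_{j1}\rangle\, e^{2\pi i kx},\qquad g_{j'2}(x)=\sum_{k\in\mathbb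 Z}\langle b,V^kh_{j'2}\rangle\, e^{2\pi i kx}, \] and let $\mathbf G_1(x)=\big(g_{j1}(x+\tfrac{k-1}{r})\big)_{j=1..s,\,k=1..r}$ and $\mathbf G_2(x)=\big(g_{j'2}(x+\tfrac{k-1}{\bar r})\big)_{j'=1..s',\,k=1..\bar r}$. Put \[ \alpha_{\mathbf G_1}=\operatorname*{ess\,inf}_{x\in(0,1/r)}\lambda_{\min}[\mathbf G_1^*(x)\mathbf G_1(x)],\qquad \beta_{\mathbf G_1}=\operatorname*{ess\,sup}_{x\in(0,1/r)}\lambda_{\max}[\mathbf G_1^*(x)\mathbf G_1(x)], \] where $\lambda_{\min},\lambda_{\max}$ are the smallest and largest eigenvalues, and define $\alpha_{\mathbf G_2},\beta_{\mathbf G_2}$ likewise with $\bar r$ in place of $r$. Then all the functions $g_{j1}$, $j=1,\dots,s$, lie in $L^\infty(0,1)$ if and only if $\beta_{\mathbf G_1}<\infty$, and all the functions $g_{j'2}$, $j'=1,\dots,s'$, lie in $L^\infty(0,1)$ if and only if $\beta_{\mathbf G_2}<\infty$. Moreover, if all the functions $g_{j1}$ and $g_{j'2}$ lie in $L^\infty(0,1)$,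 the following statements are equivalent: (a) $\alpha_{\mathbf G_1}>0$ and $\alpha_{\mathbf G_2}>0$. (b) There exist $c_j\in\mathcal H_1$ ($j=1,\dots,s$) and $d_{j'}\in\mathcal H_2$ ($j'=1,\dots,s'$) with $c_j\otimes d_{j'}\in\mathcal A_{a,b}$ for all $j,j'$, such that $\{(U^{rn}\otimes V^{\bar rm})(c_j\otimes d_{j'})\}_{j,j',\,n,m\in\mathbb Z}$ is a frame for $\mathcal A_{a,b}$ and, for every $x\in\mathcal A_{a,b}$, \[ x=\sum_{j=1}^{s}\sum_{j'=1}^{s'}\sum_{n\in\mathbb Z}\sum_{m\in\mathbb Z}\mathcal L_{jj'}x(rn,\bar rm)\,(U^{rn}\otimes V^{\bar rm})(c_j\otimes d_{j'}) \] with unconditional convergence in $\mathcal H_1\otimes\mathcal H_2$. (c) There exists a frame $\{C_{j,j',n,m}\}_{j=1..s,\,j'=1..s',\,n,m\in\mathbb Z}$ for $\mathcal A_{a,b}$ such that, for every $x\in\mathcal A_{a,b}$, \[ x=\sum_{j=1}^{s}\sum_{j'=1}^{s'}\sum_{n\in\mathbb Z}\sum_{m\in\mathbb Z}\mathcal L_{jj'}x(rn,\bar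 rm)\,C_{j,j',n,m} \] with unconditional convergence in $\mathcal H_1\otimes\mathcal H_2$. -/

import Mathlib

open MeasureTheory AddCircle
open scoped ENNReal Matrix TensorProduct

noncomputable section

namespace TensorSampling

/-! ### Riesz bases, Riesz sequences and frames -/

section Bases

variable {ι E : Type*} [NormedAddCommGroup E] [InnerProductSpace ℂ E]

/-- The closed linear span of a family of vectors. -/
def closedSpan (x : ι → E) : Submodule ℂ E :=
  (Submodule.span ℂ (Set.range x)).topologicalClosure

theorem mem_closedSpan (x : ι → E) (i : ι) : x i ∈ closedSpan x :=
  Submodule.le_topologicalClosure _ (Submodule.subset_span (Set.mem_range_self i))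

/-- A Riesz basis: the image of an orthonormal basis under a bounded operator with bounded
inverse. -/
def IsRieszBasis (x : ι → E) : Prop :=
  ∃ (e : HilbertBasis ι ℂ E) (T : E ≃L[ℂ] E), ∀ i, T (e i) = x i

/-- A Riesz sequence: a Riesz basis of its closed linear span. -/
def IsRieszSequence (x : ι → E) : Prop :=
  IsRieszBasis fun i => (⟨x i, mem_closedSpan x i⟩ : closedSpan x)

/-- `x` is a frame for the (closed) subspace `K`: its members lie in `K` and
`A ‖f‖² ≤ ∑ |⟨f, xᵢ⟩|² ≤ B ‖f‖²` on `K` for some constants `A, B > 0`. -/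
def IsFrameFor (K : Submodule ℂ E) (x : ι → E) : Prop :=
  (∀ i, x i ∈ K) ∧ ∃ A B : ℝ, 0 < A ∧ 0 < B ∧ ∀ f ∈ K,
    Summable (fun i => ‖inner ℂ (x i) f‖ ^ 2) ∧
    A * ‖f‖ ^ 2 ≤ ∑' i, ‖inner ℂ (x i) f‖ ^ 2 ∧
    ∑' i, ‖inner ℂ (x i) f‖ ^ 2 ≤ B * ‖f‖ ^ 2

end Bases

/-! ### The Hilbert space tensor product -/

section Tensor

variable (H₁ H₂ : Type*) [NormedAddCommGroup H₁] [InnerProductSpace ℂ H₁]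
  [NormedAddCommGroup H₂] [InnerProductSpace ℂ H₂]

/-- The Hilbert space tensor product: the completion of the algebraic tensor product for the
inner product with `⟨u ⊗ v, u' ⊗ v'⟩ = ⟨u, u'⟩ ⟨v, v'⟩`. -/
abbrev HTensor : Type _ := UniformSpace.Completion (H₁ ⊗[ℂ] H₂)

variable {H₁ H₂}

/-- The elementary tensor `u ⊗ v`. -/
def tmul (u : H₁) (v : H₂) : HTensor H₁ H₂ := ((u ⊗ₜ[ℂ] v : H₁ ⊗[ℂ] H₂) : HTensor H₁ H₂)

/-- The tensor product `S ⊗ T` of two bounded operators. -/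
def opTensor (S : H₁ →L[ℂ] H₁) (T : H₂ →L[ℂ] H₂) : HTensor H₁ H₂ →L[ℂ] HTensor H₁ H₂ :=
  (TensorProduct.mapL S T).completion

theorem opTensor_tmul (S : H₁ →L[ℂ] H₁) (T : H₂ →L[ℂ] H₂) (u : H₁) (v : H₂) :
    opTensor S T (tmul u v) = tmul (S u) (T v) := by
  simp [opTensor, tmul]

theorem inner_tmul (u u' : H₁) (v v' : H₂) :
    inner ℂ (tmul u v) (tmul u' v') = inner ℂ u u' * inner ℂ v v' := by
  simp [tmul]

/-- The integer power `Uⁿ` of a unitary operator, as a bounded operator. -/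
def unitaryPow {H : Type*} [NormedAddCommGroup H] [InnerProductSpace ℂ H]
    (U : H ≃ₗᵢ[ℂ] H) (n : ℤ) : H →L[ℂ] H :=
  ((U ^ n : H ≃ₗᵢ[ℂ] H).toContinuousLinearEquiv : H →L[ℂ] H)

variable (U : H₁ ≃ₗᵢ[ℂ] H₁) (V : H₂ ≃ₗᵢ[ℂ] H₂)

/-- The subspace `𝓐_{a,b}`, the closed span of `Uⁿ a ⊗ Vᵐ b`, `n, m ∈ ℤ`. -/
def generatedSpace (a : H₁) (b : H₂) : Submodule ℂ (HTensor H₁ H₂) :=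
  closedSpan fun p : ℤ × ℤ => tmul (unitaryPow U p.1 a) (unitaryPow V p.2 b)

/-- The value at `(k, l)` of the `UV`-system defined by `h ⊗ h'`:
`(𝓛 x)(k, l) = ⟨x, Uᵏ h ⊗ Vˡ h'⟩` (the inner product being linear in `x`). -/
def sample (h : H₁) (h' : H₂) (x : HTensor H₁ H₂) (k l : ℤ) : ℂ :=
  inner ℂ (tmul (unitaryPow U k h) (unitaryPow V l h')) x

end Tensor

/-! ### The functions `g` and the matrix `G` -/

section Symbol

variable {H : Type*} [NormedAddCommGroup H] [InnerProductSpace ℂ H]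

/-- The `1`-periodic function `g(x) = ∑ₖ ⟨a, Uᵏ h⟩ e^{2πikx}` (unconditionally convergent series
in `L²(0,1)`). -/
def symbol (U : H ≃ₗᵢ[ℂ] H) (a h : H) : Lp ℂ 2 (haarAddCircle (T := (1 : ℝ))) :=
  ∑' k : ℤ, (inner ℂ (unitaryPow U k h) a : ℂ) • fourierLp 2 k

/-- The series defining `symbol` does converge. -/
theorem hasSum_symbol [CompleteSpace H] (U : H ≃ₗᵢ[ℂ] H) (a h : H)
    (ha : IsRieszSequence fun n : ℤ => unitaryPow U n a) :
    HasSum (fun k : ℤ => (inner ℂ (unitaryPow U k h) a : ℂ) •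
      (fourierLp 2 k : Lp ℂ 2 (haarAddCircle (T := (1 : ℝ))))) (symbol U a h) := by
  obtain ⟨e, T, hT⟩ := ha
  have hc : CompleteSpace (closedSpan fun n : ℤ => unitaryPow U n a) :=
    (Submodule.isClosed_topologicalClosure _).completeSpace_coe
  let S : closedSpan (fun n : ℤ => unitaryPow U n a) →L[ℂ] H :=
    (closedSpan fun n : ℤ => unitaryPow U n a).subtypeL ∘L
      (T : _ →L[ℂ] closedSpan fun n : ℤ => unitaryPow U n a)
  have hS : ∀ n : ℤ, S (e n) = unitaryPow U n a := fun n => by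
    simp [S, hT]
  have hk : ∀ k : ℤ, (inner ℂ (unitaryPow U k h) a : ℂ)
      = inner ℂ (ContinuousLinearMap.adjoint S h) (e (-k)) := fun k => by
    rw [ContinuousLinearMap.adjoint_inner_left, hS]
    have h1 : unitaryPow U k (unitaryPow U (-k) a) = a := by
      change (U ^ k * U ^ (-k)) a = a
      rw [← zpow_add]
      simp
    conv_lhs => rw [← h1]
    exact (U ^ k : H ≃ₗᵢ[ℂ] H).inner_map_map h _
  have hsum : Summable fun k : ℤ => ‖(inner ℂ (unitaryPow U k h) a : ℂ)‖ ^ 2 := by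
    have h2 := e.orthonormal.inner_products_summable (ContinuousLinearMap.adjoint S h)
    refine (((Equiv.neg ℤ).summable_iff).2 h2).congr fun k => ?_
    rw [hk, norm_inner_symm]
    simp
  have hmem : Memℓp (fun k : ℤ => (inner ℂ (unitaryPow U k h) a : ℂ)) 2 := by
    refine memℓp_gen ?_
    simpa using hsum
  have h3 := (fourierBasis (T := (1 : ℝ))).hasSum_repr_symm ⟨_, hmem⟩
  simp only [coe_fourierBasis] at h3
  exact h3.summable.hasSum

variable {s : ℕ}

/-- The `s × r` matrix `G(x)` with entries `g_j(x + k / r)`, `j < s`, `0 ≤ k < r`, for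
`1`-periodic functions `g_j`. -/
def symbolMatrix (r : ℕ) (g : Fin s → UnitAddCircle → ℂ) (x : ℝ) : Matrix (Fin s) (Fin r) ℂ :=
  Matrix.of fun j k => g j ((x + (k : ℝ) / (r : ℝ) : ℝ) : UnitAddCircle)

/-- The smallest eigenvalue of `M* M`. -/
def lambdaMin {r : ℕ} (M : Matrix (Fin s) (Fin r) ℂ) : ℝ :=
  ⨅ i, (Matrix.isHermitian_conjTranspose_mul_self M).eigenvalues i

/-- The largest eigenvalue of `M* M`. -/
def lambdaMax {r : ℕ} (M : Matrix (Fin s) (Fin r) ℂ) : ℝ :=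
  ⨆ i, (Matrix.isHermitian_conjTranspose_mul_self M).eigenvalues i

/-- The constant `α_G`, the essential infimum over `(0, 1/r)` of `λ_min [G*(x) G(x)]`. -/
def alphaG (r : ℕ) (g : Fin s → UnitAddCircle → ℂ) : ℝ≥0∞ :=
  essInf (fun x : ℝ => ENNReal.ofReal (lambdaMin (symbolMatrix r g x)))
    (volume.restrict (Set.Ioo 0 (1 / (r : ℝ))))

/-- The constant `β_G`, the essential supremum over `(0, 1/r)` of `λ_max [G*(x) G(x)]`. -/
def betaG (r : ℕ) (g : Fin s → UnitAddCircle → ℂ) : ℝ≥0∞ :=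
  essSup (fun x : ℝ => ENNReal.ofReal (lambdaMax (symbolMatrix r g x)))
    (volume.restrict (Set.Ioo 0 (1 / (r : ℝ))))

end Symbol

end TensorSampling

end

open TensorSampling

/-! Everything is moved to the circle. The isomorphism of L²(0,1) onto the closed span of the orbit
of a, with e_n ↦ Uⁿa (`exists_fourier_synthesis`), turns the samples of the image of F into the
Fourier coefficients of g_j F at the multiples of r (`inner_synthesis_eq_fourierCoeff`). By Parseval
their square sum is, up to the factor r⁻², the integral of |∑ₖ (g_j F)(x + k/r)|² summed over j, and
the inner sums are the entries of G(x) applied to the vector of translates of F. Hence α_G > 0 says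
exactly that the samples bound ‖u‖² from above on the orbit span (`alphaG_pos_iff_integral`,
`alphaG_pos_iff_samples`); boundedness of the g_j gives the opposite estimate (`samples_bound`).

(a) ⇒ (b): under both estimates the projections of the U^{rn}h_j form a frame of the orbit span. The
inverse of its frame operator commutes with U^{rn}, so the canonical dual is again an orbit
U^{rn}c_j (`exists_dual`, `exists_dual_samples`). The formulas in the two factors are then tensored:
tensor products of Bessel families are Bessel (`IsBessel.tmul`), so the reconstruction operator is
bounded and only has to be compared with the identity on the vectors Uⁿa ⊗ Vᵐb
(`hasSum_tensor_reconstruction`).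

(c) ⇒ (a): the upper frame bound of C gives ‖x‖² ≤ B ∑|samples of x|². For x = u ⊗ v both sides
factor; with v = b ≠ 0 fixed, a lower estimate for u remains, and symmetrically for v
(`alphaG_pos_of_frame`).

The claims on β_G hold because λ_max[G*G] dominates the squared modulus of each entry of G and is
dominated by the sum of them all. -/

namespace TensorSampling

/-! ### Bessel families, frames and canonical duals -/

section Bessel

variable {ι E : Type*} [NormedAddCommGroup E] [InnerProductSpace ℂ E]

/-- The Hilbert space of square summable families of complex numbers. -/
abbrev EllTwo (ι : Type*) : Type _ := lp (fun _ : ι => ℂ) 2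

open Classical in
/-- The standard unit vector of `EllTwo ι`. -/
noncomputable def ellUnit (i : ι) : EllTwo ι := lp.single 2 i (1 : ℂ)

/-- A Bessel family: the image of the standard basis of `ℓ²` under a bounded operator. -/
def IsBessel (x : ι → E) : Prop :=
  ∃ Y : EllTwo ι →L[ℂ] E, ∀ i, Y (ellUnit i) = x i

theorem EllTwo.hasSum_norm_sq (c : EllTwo ι) : HasSum (fun i => ‖c i‖ ^ 2) (‖c‖ ^ 2) := by
  have h := lp.hasSum_norm (p := 2) (by norm_num) c
  simpa using h

theorem EllTwo.hasSum_unit (c : EllTwo ι) : HasSum (fun i => c i • ellUnit i) c := by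
  classical
  have h := lp.hasSum_single (p := 2) (by norm_num) c
  convert h using 2 with i
  unfold ellUnit
  rw [← lp.single_smul]
  simp

open Classical in
theorem inner_ellUnit (i j : ι) :
    (inner ℂ (ellUnit i) (ellUnit j) : ℂ) = if i = j then 1 else 0 := by
  simp only [ellUnit]
  rw [lp.inner_single_left, lp.coeFn_single, Pi.single_apply]
  by_cases hij : i = j
  · simp [hij]
  · simp [hij]

theorem isClosed_closedSpan (x : ι → E) : IsClosed (closedSpan x : Set E) :=
  Submodule.isClosed_topologicalClosure _

theorem map_mem_of_mem_closedSpan {F : Type*} [NormedAddCommGroup F] [InnerProductSpace ℂ F]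
    {x : ι → E} (L : E →L[ℂ] F) {K : Submodule ℂ F} (hK : IsClosed (K : Set F))
    (h : ∀ i, L (x i) ∈ K) {u : E} (hu : u ∈ closedSpan x) : L u ∈ K := by
  have h1 : Submodule.span ℂ (Set.range x) ≤ K.comap (L : E →ₗ[ℂ] F) := by
    rw [Submodule.span_le]
    rintro _ ⟨i, rfl⟩
    exact h i
  exact Submodule.topologicalClosure_minimal _ h1 (hK.preimage L.continuous) hu

theorem eq_of_mem_closedSpan {F : Type*} [NormedAddCommGroup F] [InnerProductSpace ℂ F]
    {x : ι → E} {L M : E →L[ℂ] F} (h : ∀ i, L (x i) = M (x i)) {u : E} (hu : u ∈ closedSpan x) :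
    L u = M u := by
  have h1 : (L - M) u ∈ (⊥ : Submodule ℂ F) :=
    map_mem_of_mem_closedSpan (x := x) (L - M) (by simp) (fun i => by simp [h i]) hu
  simpa [sub_eq_zero] using h1

theorem hasSum_synthesis {x : ι → E} {Y : EllTwo ι →L[ℂ] E} (hY : ∀ i, Y (ellUnit i) = x i)
    (c : EllTwo ι) : HasSum (fun i => c i • x i) (Y c) := by
  simpa [hY] using (EllTwo.hasSum_unit c).mapL Y

theorem adjoint_synthesis_apply [CompleteSpace E] {x : ι → E} {Y : EllTwo ι →L[ℂ] E}
    (hY : ∀ i, Y (ellUnit i) = x i) (f : E) (i : ι) :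
    (ContinuousLinearMap.adjoint Y f) i = inner ℂ (x i) f := by
  classical
  rw [← hY, ← ContinuousLinearMap.adjoint_inner_right, ellUnit, lp.inner_single_left]
  simp

theorem IsBessel.bound [CompleteSpace E] {x : ι → E} (hx : IsBessel x) :
    ∃ B : ℝ, 0 < B ∧ ∀ f, Summable (fun i => ‖inner ℂ (x i) f‖ ^ 2) ∧
      ∑' i, ‖inner ℂ (x i) f‖ ^ 2 ≤ B * ‖f‖ ^ 2 := by
  obtain ⟨Y, hY⟩ := hx
  refine ⟨‖ContinuousLinearMap.adjoint Y‖ ^ 2 + 1, by positivity, fun f => ?_⟩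
  have h := EllTwo.hasSum_norm_sq (ContinuousLinearMap.adjoint Y f)
  simp only [adjoint_synthesis_apply hY] at h
  refine ⟨h.summable, h.tsum_eq.trans_le ?_⟩
  have := (ContinuousLinearMap.adjoint Y).le_opNorm f
  calc _ ≤ (‖ContinuousLinearMap.adjoint Y‖ * ‖f‖) ^ 2 := by gcongr
    _ ≤ _ := by nlinarith [sq_nonneg ‖f‖]

/-- The estimate makes the analysis map f ↦ (⟨f, xᵢ⟩) bounded into ℓ²; its adjoint is the required
synthesis operator. -/
theorem isBessel_of_bound [CompleteSpace E] {x : ι → E} {B : ℝ}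
    (h : ∀ f, Summable (fun i => ‖inner ℂ (x i) f‖ ^ 2) ∧
      ∑' i, ‖inner ℂ (x i) f‖ ^ 2 ≤ B * ‖f‖ ^ 2) : IsBessel x := by
  classical
  let L : E →ₗ[ℂ] EllTwo ι :=
    { toFun := fun f => ⟨fun i => inner ℂ (x i) f, memℓp_gen (by simpa using (h f).1)⟩
      map_add' := fun f g => by ext i; exact inner_add_right _ _ _
      map_smul' := fun c f => by ext i; exact inner_smul_right _ _ _ }
  have hL : ∀ f i, L f i = inner ℂ (x i) f := fun _ _ => rfl
  let A : E →L[ℂ] EllTwo ι := L.mkContinuous (Real.sqrt B) fun f => by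
    have h1 := (EllTwo.hasSum_norm_sq (L f)).tsum_eq
    simp only [hL] at h1
    have h2 : ‖L f‖ ^ 2 ≤ B * ‖f‖ ^ 2 := h1 ▸ (h f).2
    have h3 := Real.sqrt_le_sqrt h2
    rwa [Real.sqrt_sq (norm_nonneg _), Real.sqrt_mul' _ (sq_nonneg _),
      Real.sqrt_sq (norm_nonneg _)] at h3
  have hA : ∀ f i, A f i = inner ℂ (x i) f := fun _ _ => rfl
  refine ⟨ContinuousLinearMap.adjoint A, fun i => ?_⟩
  refine ext_inner_right ℂ fun f => ?_
  rw [ContinuousLinearMap.adjoint_inner_left, ellUnit, lp.inner_single_left, hA]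
  simp

theorem IsBessel.map {F : Type*} [NormedAddCommGroup F] [InnerProductSpace ℂ F] {x : ι → E}
    (hx : IsBessel x) (R : E →L[ℂ] F) : IsBessel fun i => R (x i) := by
  obtain ⟨Y, hY⟩ := hx
  exact ⟨R ∘L Y, fun i => by simp [hY]⟩

/-- Pair x with its own expansion and split each product by the weighted arithmetic-geometric mean
inequality. The weight t stays free so that whichever of the two sums is controlled by ‖x‖² can be
absorbed on the left. -/
theorem norm_sq_le_of_hasSum {x : E} {c : ι → ℂ} {y : ι → E} (h : HasSum (fun i => c i • y i) x)
    (hc : Summable fun i => ‖c i‖ ^ 2) (hy : Summable fun i => ‖inner ℂ (y i) x‖ ^ 2) {t : ℝ}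
    (ht : 0 < t) :
    ‖x‖ ^ 2 ≤ (t * ∑' i, ‖c i‖ ^ 2 + t⁻¹ * ∑' i, ‖inner ℂ (y i) x‖ ^ 2) / 2 := by
  have h1 : HasSum (fun i => c i * inner ℂ x (y i)) (inner ℂ x x) := by
    simpa [inner_smul_right] using h.mapL (innerSL ℂ x)
  have h2 : Summable fun i => (t * ‖c i‖ ^ 2 + t⁻¹ * ‖inner ℂ (y i) x‖ ^ 2) / 2 :=
    ((hc.mul_left t).add (hy.mul_left t⁻¹)).div_const 2
  have h3 : ∀ i, ‖c i * inner ℂ x (y i)‖ ≤ (t * ‖c i‖ ^ 2 + t⁻¹ * ‖inner ℂ (y i) x‖ ^ 2) / 2 :=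
    fun i => by
      rw [norm_mul, norm_inner_symm]
      have : 0 ≤ t⁻¹ * (t * ‖c i‖ - ‖inner ℂ (y i) x‖) ^ 2 := by positivity
      have e : t⁻¹ * (t * ‖c i‖ - ‖inner ℂ (y i) x‖) ^ 2 = t * ‖c i‖ ^ 2 +
        t⁻¹ * ‖inner ℂ (y i) x‖ ^ 2 - 2 * (‖c i‖ * ‖inner ℂ (y i) x‖) := by
          field_simp; ring
      linarith
  have h4 : ‖(inner ℂ x x : ℂ)‖ ≤ _ := h1.tsum_eq ▸ tsum_of_norm_bounded h2.hasSum h3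
  rw [inner_self_eq_norm_sq_to_K] at h4
  rw [tsum_div_const, (hc.mul_left t).tsum_add (hy.mul_left t⁻¹), tsum_mul_left,
    tsum_mul_left] at h4
  simpa using h4

/-- A reconstruction formula with Bessel coefficients turns a Bessel family into a frame. -/
theorem isFrameFor_of_reconstruction [CompleteSpace E] {K : Submodule ℂ E} {y z : ι → E}
    (hyK : ∀ i, y i ∈ K) (hy : IsBessel y) (hz : IsBessel z)
    (h : ∀ x ∈ K, HasSum (fun i => (inner ℂ (z i) x : ℂ) • y i) x) : IsFrameFor K y := by
  obtain ⟨B, hB, hyB⟩ := hy.bound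
  obtain ⟨B', hB', hzB⟩ := hz.bound
  refine ⟨hyK, B'⁻¹, B, by positivity, hB, fun f hf => ⟨(hyB f).1, ?_, (hyB f).2⟩⟩
  -- With t = 1/B' the coefficient term is at most ‖f‖², half of which is absorbed; what is left is
  -- the lower frame bound 1/B'.
  have h1 := norm_sq_le_of_hasSum (h f hf) (hzB f).1 (hyB f).1 (inv_pos.2 hB')
  have h2 : B'⁻¹ * ∑' i, ‖inner ℂ (z i) f‖ ^ 2 ≤ ‖f‖ ^ 2 := by
    rw [inv_mul_le_iff₀ hB']; exact (hzB f).2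
  rw [inv_inv] at h1
  rw [inv_mul_le_iff₀ hB']
  linarith

theorem IsFrameFor.reindex {κ : Type*} {K : Submodule ℂ E} {y : ι → E} (hy : IsFrameFor K y)
    (e : κ ≃ ι) : IsFrameFor K fun k => y (e k) := by
  obtain ⟨hyK, A, B, hA, hB, h⟩ := hy
  refine ⟨fun k => hyK _, A, B, hA, hB, fun f hf => ?_⟩
  obtain ⟨h1, h2, h3⟩ := h f hf
  have h4 := e.tsum_eq fun i => ‖inner ℂ (y i) f‖ ^ 2
  exact ⟨e.summable_iff.2 h1, h4.symm ▸ h2, h4.symm ▸ h3⟩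

/-- Only the upper frame bound matters. The weight t = B absorbs the analysis sum of x, leaving the
coefficients, which need not be the canonical ones. -/
theorem norm_sq_le_of_frame {K : Submodule ℂ E} {y : ι → E} (hy : IsFrameFor K y) :
    ∃ B : ℝ, 0 < B ∧ ∀ x ∈ K, ∀ c : ι → ℂ, (Summable fun i => ‖c i‖ ^ 2) →
      HasSum (fun i => c i • y i) x → ‖x‖ ^ 2 ≤ B * ∑' i, ‖c i‖ ^ 2 := by
  obtain ⟨-, A, B, -, hB, h⟩ := hy
  refine ⟨B, hB, fun x hx c hc hs => ?_⟩
  have h1 := norm_sq_le_of_hasSum hs hc (h x hx).1 hB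
  have h2 : B⁻¹ * ∑' i, ‖inner ℂ (y i) x‖ ^ 2 ≤ ‖x‖ ^ 2 := by
    rw [inv_mul_le_iff₀ hB]; exact (h x hx).2.2
  linarith

theorem starProjection_comm {K : Submodule ℂ E} [K.HasOrthogonalProjection] {W : E ≃ₗᵢ[ℂ] E}
    (hW : ∀ x, W x ∈ K ↔ x ∈ K) (f : E) : K.starProjection (W f) = W (K.starProjection f) := by
  refine Submodule.eq_starProjection_of_mem_of_inner_eq_zero
    ((hW _).2 (K.starProjection_apply_mem f)) fun w hw => ?_
  have h1 : W.symm w ∈ K := by rw [← hW, W.apply_symm_apply]; exact hw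
  rw [← map_sub, ← W.apply_symm_apply w, W.inner_map_map]
  exact K.starProjection_inner_eq_zero f _ h1

/-- The canonical dual of a frame of a closed subspace, together with the operator producing it,
which commutes with the unitary operators permuting the frame. -/
theorem exists_dual [CompleteSpace E] {K : Submodule ℂ E} [K.HasOrthogonalProjection] {z : ι → E}
    (hzK : ∀ i, z i ∈ K) (hz : IsBessel z) {A : ℝ} (hA : 0 < A)
    (hlow : ∀ f ∈ K, A * ‖f‖ ^ 2 ≤ ∑' i, ‖inner ℂ (z i) f‖ ^ 2) :
    ∃ R : E →L[ℂ] E, (∀ f ∈ K, R f ∈ K) ∧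
      (∀ f ∈ K, HasSum (fun i => (inner ℂ (z i) f : ℂ) • R (z i)) f) ∧
      ∀ (W : E ≃ₗᵢ[ℂ] E) (σ : ι ≃ ι), (∀ x, W x ∈ K ↔ x ∈ K) → (∀ i, W (z i) = z (σ i)) →
        ∀ x, R (W x) = W (R x) := by
  obtain ⟨Y, hY⟩ := hz
  set Θ := ContinuousLinearMap.adjoint Y with hΘ
  have hΘa : ∀ f i, Θ f i = inner ℂ (z i) f := adjoint_synthesis_apply hY
  have hsum : ∀ f, HasSum (fun i => (inner ℂ (z i) f : ℂ) • z i) (Y (Θ f)) := fun f => by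
    simpa [hΘa] using hasSum_synthesis hY (Θ f)
  set P := K.starProjection with hP
  have hPK : ∀ f, P f ∈ K := fun f => K.starProjection_apply_mem f
  have hPo : ∀ f, ∀ w ∈ K, inner ℂ (f - P f) w = 0 := fun f w hw =>
    K.starProjection_inner_eq_zero f w hw
  have hPs : ∀ f ∈ K, P f = f := fun f hf => Submodule.starProjection_eq_self_iff.2 hf
  -- The frame operator lives on K only. Adding the projection onto the orthogonal complement gives
  -- an operator that can be inverted on all of E.
  let S : E →L[ℂ] E := Y ∘L Θ + (ContinuousLinearMap.id ℂ E - P)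
  have hS : ∀ f, S f = Y (Θ f) + (f - P f) := fun f => rfl
  have hYK : ∀ f, Y (Θ f) ∈ K := fun f => by
    have hcl : IsClosed (K : Set E) := by
      have h1 : (K : Set E) = {x | P x = x} := by
        ext x; exact Submodule.starProjection_eq_self_iff.symm
      rw [h1]; exact isClosed_eq P.continuous continuous_id
    exact hcl.mem_of_tendsto (hsum f)
      (Filter.Eventually.of_forall fun s => K.sum_mem fun i _ => K.smul_mem _ (hzK i))
  have hΘP : ∀ f, Θ (P f) = Θ f := fun f => by
    ext i
    rw [hΘa, hΘa, ← sub_eq_zero, ← inner_sub_right, ← inner_conj_symm, ← neg_sub, inner_neg_left,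
      hPo f _ (hzK i)]
    simp
  have hin : ∀ f, (inner ℂ (S f) f : ℂ) = ((‖Θ f‖ ^ 2 + ‖f - P f‖ ^ 2 : ℝ) : ℂ) := fun f => by
    have h1 : (inner ℂ (Y (Θ f)) f : ℂ) = inner ℂ (Θ f) (Θ f) := by
      rw [hΘ, ContinuousLinearMap.adjoint_inner_right]
    have h2 : (inner ℂ (f - P f) f : ℂ) = inner ℂ (f - P f) (f - P f) := by
      rw [inner_sub_right, hPo f _ (hPK f), sub_zero]
    rw [hS, inner_add_left, h1, h2, inner_self_eq_norm_sq_to_K, inner_self_eq_norm_sq_to_K]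
    push_cast; rfl
  have hpy : ∀ f, ‖f‖ ^ 2 = ‖P f‖ ^ 2 + ‖f - P f‖ ^ 2 := fun f => by
    have h := norm_add_sq_eq_norm_sq_add_norm_sq_of_inner_eq_zero (𝕜 := ℂ) (f - P f) (P f)
      (hPo f _ (hPK f))
    rw [sub_add_cancel] at h
    nlinarith
  have hΘn : ∀ f, A * ‖P f‖ ^ 2 ≤ ‖Θ f‖ ^ 2 := fun f => by
    have h := (EllTwo.hasSum_norm_sq (Θ (P f))).tsum_eq
    simp only [hΘa] at h
    rw [← hΘP, ← h]
    exact hlow _ (hPK f)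
  -- Lax–Milgram: ⟨S f, f⟩ ≥ A‖P f‖² + ‖f − P f‖² ≥ min(A, 1)‖f‖².
  have hunit : IsUnit S := by
    have hm : 0 < min A 1 := lt_min hA one_pos
    refine S.isUnit_of_forall_le_norm_inner_map (Real.toNNReal_pos.2 hm) fun f => ?_
    rw [Real.coe_toNNReal _ hm.le]
    rw [hin, Complex.norm_real, Real.norm_of_nonneg (by positivity), hpy]
    have h1 := hΘn f
    have h2 : min A 1 * ‖P f‖ ^ 2 ≤ A * ‖P f‖ ^ 2 := by gcongr; exact min_le_left _ _
    have h3 : min A 1 * ‖f - P f‖ ^ 2 ≤ 1 * ‖f - P f‖ ^ 2 := by gcongr; exact min_le_right _ _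
    linarith
  obtain ⟨u, hu⟩ := hunit
  set R : E →L[ℂ] E := ((u⁻¹ : (E →L[ℂ] E)ˣ) : E →L[ℂ] E) with hR
  have hRS : ∀ x, R (S x) = x := fun x => by
    have h : R * S = 1 := by rw [hR, ← hu, Units.inv_mul]
    exact DFunLike.congr_fun h x
  have hSR : ∀ x, S (R x) = x := fun x => by
    have h : S * R = 1 := by rw [hR, ← hu, Units.mul_inv]
    exact DFunLike.congr_fun h x
  refine ⟨R, fun f hf => ?_, fun f hf => ?_, fun W σ hWK hWz x => ?_⟩
  -- From S(R f) = f, the component of R f orthogonal to K equals f − YΘ(R f), a difference of two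
  -- elements of K.
  · have h1 : R f - P (R f) ∈ K := by
      have h2 := hS (R f)
      rw [hSR] at h2
      rw [eq_sub_iff_add_eq'.2 h2.symm]
      exact K.sub_mem hf (hYK _)
    have h3 := K.add_mem h1 (hPK (R f))
    rwa [sub_add_cancel] at h3
  · have h1 := (hsum f).mapL R
    have h2 : S f = Y (Θ f) := by rw [hS, hPs f hf, sub_self, add_zero]
    rw [← h2, hRS] at h1
    simpa using h1
  · have hPW : ∀ f, P (W f) = W (P f) := starProjection_comm hWK
    -- Since W only permutes the family, reindexing the frame sum of W f by σ turns it into W of the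
    -- frame sum of f.
    have hYW : ∀ f, Y (Θ (W f)) = W (Y (Θ f)) := fun f => by
      have h1 := (σ.hasSum_iff).2 (hsum (W f))
      have h2 := (hsum f).mapL (W.toContinuousLinearEquiv : E →L[ℂ] E)
      have h3 : HasSum ((fun i => (inner ℂ (z i) (W f) : ℂ) • z i) ∘ σ) (W (Y (Θ f))) := by
        have h2' : HasSum _ (W (Y (Θ f))) := h2
        convert h2' using 2 with i
        have h4 : ((W.toContinuousLinearEquiv : E →L[ℂ] E)) ((inner ℂ (z i) f : ℂ) • z i) =
          (inner ℂ (z i) f : ℂ) • W (z i) := map_smul W _ _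
        refine Eq.trans ?_ h4.symm
        simp [← hWz, W.inner_map_map]
      exact h1.unique h3
    have hSW : ∀ f, S (W f) = W (S f) := fun f => by
      rw [hS, hS, hPW, hYW, map_add, map_sub]
    have h := hRS (W (R x))
    rw [hSW, hSR] at h
    exact h

end Bessel

/-! ### Bessel families in the Hilbert space tensor product -/

section TensorBessel

variable {H₁ H₂ : Type*} [NormedAddCommGroup H₁] [InnerProductSpace ℂ H₁]
  [NormedAddCommGroup H₂] [InnerProductSpace ℂ H₂]

theorem norm_tmul (u : H₁) (v : H₂) : ‖tmul u v‖ = ‖u‖ * ‖v‖ := by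
  simp [tmul]

/-- The elementary tensor `u ⊗ v` as a bounded operator in `u`. -/
noncomputable def tmulRight (v : H₂) : H₁ →L[ℂ] HTensor H₁ H₂ :=
  LinearMap.mkContinuous
    ((UniformSpace.Completion.toComplₗᵢ (𝕜 := ℂ) (E := H₁ ⊗[ℂ] H₂)).toLinearMap ∘ₗ
      (TensorProduct.mk ℂ H₁ H₂).flip v) ‖v‖ fun u => by
    change ‖tmul u v‖ ≤ _
    rw [norm_tmul, mul_comm]

/-- The elementary tensor `u ⊗ v` as a bounded operator in `v`. -/
noncomputable def tmulLeft (u : H₁) : H₂ →L[ℂ] HTensor H₁ H₂ :=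
  LinearMap.mkContinuous
    ((UniformSpace.Completion.toComplₗᵢ (𝕜 := ℂ) (E := H₁ ⊗[ℂ] H₂)).toLinearMap ∘ₗ
      TensorProduct.mk ℂ H₁ H₂ u) ‖u‖ fun v => by
    change ‖tmul u v‖ ≤ _
    rw [norm_tmul]

theorem tmulRight_apply (u : H₁) (v : H₂) : tmulRight v u = tmul u v := rfl

theorem tmulLeft_apply (u : H₁) (v : H₂) : tmulLeft u v = tmul u v := rfl

/-- Elementary tensors of standard unit vectors are orthonormal, so ℓ²(ι₁ × ι₂) embeds isometrically
in ℓ²(ι₁) ⊗ ℓ²(ι₂). The synthesis operator is this embedding followed by X ⊗ Y. -/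
theorem IsBessel.tmul {ι₁ ι₂ : Type*} {x : ι₁ → H₁} {y : ι₂ → H₂} (hx : IsBessel x)
    (hy : IsBessel y) : IsBessel fun p : ι₁ × ι₂ => tmul (x p.1) (y p.2) := by
  classical
  obtain ⟨X, hX⟩ := hx
  obtain ⟨Y, hY⟩ := hy
  let e : ι₁ × ι₂ → HTensor (EllTwo ι₁) (EllTwo ι₂) := fun p =>
    TensorSampling.tmul (ellUnit p.1) (ellUnit p.2)
  have he : Orthonormal ℂ e := by
    rw [orthonormal_iff_ite]
    rintro ⟨i, j⟩ ⟨i', j'⟩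
    simp only [e, inner_tmul, inner_ellUnit, Prod.mk.injEq]
    split_ifs <;> simp_all
  let J := he.orthogonalFamily.linearIsometry
  refine ⟨(TensorProduct.mapL X Y).completion ∘L J.toContinuousLinearMap, fun p => ?_⟩
  have h1 : J (ellUnit p) = e p := by
    let _ : DecidableEq (ι₁ × ι₂) := fun a b => Classical.propDecidable (a = b)
    refine (he.orthogonalFamily.linearIsometry_apply_single (i := p) (1 : ℂ)).trans ?_
    simp
  rw [ContinuousLinearMap.comp_apply, LinearIsometry.coe_toContinuousLinearMap, h1]
  simp [e, TensorSampling.tmul, hX, hY]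

theorem tmul_mem_closedSpan {ι₁ ι₂ : Type*} {x : ι₁ → H₁} {y : ι₂ → H₂} {u : H₁} {v : H₂}
    (hu : u ∈ closedSpan x) (hv : v ∈ closedSpan y) :
    tmul u v ∈ closedSpan fun p : ι₁ × ι₂ => tmul (x p.1) (y p.2) := by
  refine map_mem_of_mem_closedSpan (tmulRight v) (isClosed_closedSpan _) (fun i => ?_) hu
  exact map_mem_of_mem_closedSpan (tmulLeft (x i)) (isClosed_closedSpan _)
    (fun j => mem_closedSpan (fun p : ι₁ × ι₂ => tmul (x p.1) (y p.2)) (i, j)) hv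

end TensorBessel

/-! ### Periodization and Fourier coefficients at multiples of r -/

section Periodization

variable {r : ℕ}

/-- The sum of the translates of `f` by the multiples of `1 / r`. -/
noncomputable def periodize {M : Type*} [AddCommMonoid M] (r : ℕ) (f : UnitAddCircle → M)
    (t : UnitAddCircle) : M :=
  ∑ k ∈ Finset.range r, f (t + ((k / r : ℝ) : UnitAddCircle))

/-- The shift permutes the summands cyclically: the last one wraps round to the first because the
circle has period 1. -/
theorem periodize_add {M : Type*} [AddCommMonoid M] (hr : 0 < r) (f : UnitAddCircle → M)
    (t : UnitAddCircle) : periodize r f (t + ((1 / r : ℝ) : UnitAddCircle)) = periodize r f t := by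
  obtain ⟨n, rfl⟩ : ∃ n, r = n + 1 := ⟨r - 1, by omega⟩
  have hn : ((n + 1 : ℕ) : ℝ) ≠ 0 := by positivity
  unfold periodize
  rw [Finset.sum_range_succ, Finset.sum_range_succ']
  congr 1
  · refine Finset.sum_congr rfl fun k _ => ?_
    rw [add_assoc, ← AddCircle.coe_add]
    congr 3
    push_cast
    ring
  · rw [add_assoc, ← AddCircle.coe_add]
    have : (1 / ((n + 1 : ℕ) : ℝ) + (n : ℝ) / ((n + 1 : ℕ) : ℝ)) = 1 := by
      field_simp; push_cast; ring
    rw [this, AddCircle.coe_period]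
    simp

theorem single_le_periodize (hr : 0 < r) {f : UnitAddCircle → ℝ} (hf : ∀ t, 0 ≤ f t)
    (t : UnitAddCircle) : f t ≤ periodize r f t := by
  have h := Finset.single_le_sum (f := fun k : ℕ => f (t + ((k / r : ℝ) : UnitAddCircle)))
    (fun k _ => hf _) (Finset.mem_range.2 hr)
  simpa [periodize] using h

theorem measurable_periodize {f : UnitAddCircle → ℂ} (hf : Measurable f) :
    Measurable (periodize r f) :=
  Finset.measurable_fun_sum _ fun _ _ => hf.comp (measurable_add_const _)

theorem measurable_periodize_real {f : UnitAddCircle → ℝ} (hf : Measurable f) :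
    Measurable (periodize r f) :=
  Finset.measurable_fun_sum _ fun _ _ => hf.comp (measurable_add_const _)

theorem memLp_periodize {p : ℝ≥0∞} {f : UnitAddCircle → ℂ} (hf : MemLp f p haarAddCircle) :
    MemLp (periodize r f) p haarAddCircle :=
  memLp_finsetSum _ fun _ _ =>
    hf.comp_measurePreserving (measurePreserving_add_right haarAddCircle _)

theorem integrable_periodize {f : UnitAddCircle → ℝ} (hf : Integrable f haarAddCircle) :
    Integrable (periodize r f) haarAddCircle :=
  integrable_finsetSum _ fun _ _ =>
    (measurePreserving_add_right haarAddCircle _).integrable_comp_of_integrable hf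

theorem integral_periodize {f : UnitAddCircle → ℝ} (hf : Integrable f haarAddCircle) :
    ∫ t, periodize r f t ∂haarAddCircle = r * ∫ t, f t ∂haarAddCircle := by
  unfold periodize
  have h (k : ℕ) : Integrable (fun t => f (t + ((k / r : ℝ) : UnitAddCircle))) haarAddCircle :=
    (measurePreserving_add_right haarAddCircle _).integrable_comp_of_integrable hf
  rw [integral_finsetSum _ fun k _ => h k]
  simp only [integral_add_right_eq_self (μ := haarAddCircle) f]
  simp

theorem fourierCoeff_translate (f : UnitAddCircle → ℂ) (c : UnitAddCircle) (m : ℤ) :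
    fourierCoeff (fun t => f (t + c)) m = fourier m c * fourierCoeff f m := by
  unfold fourierCoeff
  rw [← integral_add_right_eq_self (μ := haarAddCircle) (fun t => fourier (-m) t • f t) c,
    ← integral_const_mul]
  refine integral_congr_ae (Filter.Eventually.of_forall fun t => ?_)
  have h1 : (fourier (-m) (t + c) : ℂ) = fourier (-m) t * fourier (-m) c := by
    simp [fourier_apply, toCircle_add]
  have h2 : (fourier m c : ℂ) * fourier (-m) c = 1 := by
    rw [← fourier_add]; simp
  simp only [smul_eq_mul, h1]
  linear_combination (-(fourier (-m) t : ℂ) * f (t + c)) * h2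

/-- A geometric sum in the r-th root of unity ζ = e^{2πim/r}, which equals 1 exactly when r divides
m. -/
theorem sum_fourier_div (hr : 0 < r) (m : ℤ) :
    ∑ k ∈ Finset.range r, (fourier m ((k / r : ℝ) : UnitAddCircle) : ℂ) =
      if (r : ℤ) ∣ m then (r : ℂ) else 0 := by
  have hr0 : (r : ℂ) ≠ 0 := by exact_mod_cast hr.ne'
  set ζ : ℂ := Complex.exp (2 * Real.pi * Complex.I * m / r) with hζ
  have h1 : ∀ k : ℕ, (fourier m ((k / r : ℝ) : UnitAddCircle) : ℂ) = ζ ^ k := fun k => by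
    rw [fourier_coe_apply, hζ, ← Complex.exp_nat_mul]
    congr 1
    push_cast
    field_simp
  simp only [h1]
  have h2 : ζ = 1 ↔ (r : ℤ) ∣ m := by
    rw [hζ, Complex.exp_eq_one_iff]
    have hpi : (2 * Real.pi * Complex.I : ℂ) ≠ 0 := Complex.two_pi_I_ne_zero
    constructor
    · rintro ⟨n, hn⟩
      refine ⟨n, ?_⟩
      have : (m : ℂ) = r * n := by
        field_simp at hn
        exact hn
      exact_mod_cast this
    · rintro ⟨n, rfl⟩
      refine ⟨n, ?_⟩
      push_cast
      field_simp
  split_ifs with h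
  · rw [h2.2 h]; simp
  · rw [geom_sum_eq (mt h2.1 h)]
    have : ζ ^ r = 1 := by
      rw [hζ, ← Complex.exp_nat_mul, Complex.exp_eq_one_iff]
      exact ⟨m, by field_simp⟩
    simp [this]

theorem fourierCoeff_periodize (hr : 0 < r) {f : UnitAddCircle → ℂ}
    (hf : Integrable f haarAddCircle) (m : ℤ) :
    fourierCoeff (periodize r f) m = if (r : ℤ) ∣ m then r * fourierCoeff f m else 0 := by
  have h1 : fourierCoeff (periodize r f) m = ∑ k ∈ Finset.range r,
      fourierCoeff (fun t => f (t + ((k / r : ℝ) : UnitAddCircle))) m := by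
    unfold fourierCoeff periodize
    simp only [Finset.smul_sum]
    refine integral_finsetSum _ fun k _ => ?_
    exact ((measurePreserving_add_right haarAddCircle
      ((k / r : ℝ) : UnitAddCircle)).integrable_comp_of_integrable hf).fourier_smul _
  rw [h1]
  simp only [fourierCoeff_translate]
  rw [← Finset.sum_mul, sum_fourier_div hr]
  split_ifs <;> simp

/-- Parseval's identity for the Fourier coefficients at the multiples of `r`. -/
theorem hasSum_sq_fourierCoeff_mul (hr : 0 < r) {f : UnitAddCircle → ℂ}
    (hf : MemLp f 2 haarAddCircle) :
    HasSum (fun n : ℤ => ‖fourierCoeff f (r * n)‖ ^ 2)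
      ((r : ℝ)⁻¹ ^ 2 * ∫ t, ‖periodize r f t‖ ^ 2 ∂haarAddCircle) := by
  have hr0 : (r : ℝ) ≠ 0 := by exact_mod_cast hr.ne'
  have hP := memLp_periodize (r := r) hf
  have h1 := hasSum_sq_fourierCoeff (hP.toLp _)
  have h2 : ∀ i, fourierCoeff (hP.toLp _) i = fourierCoeff (periodize r f) i := fun i =>
    congrFun (fourierCoeff_congr_ae hP.coeFn_toLp) i
  have h3 : ∫ t, ‖hP.toLp _ t‖ ^ 2 ∂haarAddCircle =
      ∫ t, ‖periodize r f t‖ ^ 2 ∂haarAddCircle := by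
    refine integral_congr_ae ?_
    filter_upwards [hP.coeFn_toLp] with t ht
    rw [ht]
  simp only [h2, h3, fourierCoeff_periodize hr (hf.integrable (by norm_num))] at h1
  have hinj : Function.Injective fun n : ℤ => (r : ℤ) * n :=
    mul_right_injective₀ (by exact_mod_cast hr.ne')
  -- Parseval for the periodization has nonzero terms only at multiples of r, so it is a sum over n
  -- ↦ rn.
  rw [← hinj.hasSum_iff] at h1
  · have h4 : (fun n : ℤ => ‖fourierCoeff f (r * n)‖ ^ 2) = fun n => (r : ℝ)⁻¹ ^ 2 *
        ((fun i => ‖if (r : ℤ) ∣ i then (r : ℂ) * fourierCoeff f i else 0‖ ^ 2) ∘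
          fun n => (r : ℤ) * n) n := by
      funext n
      simp only [Function.comp_apply, dvd_mul_right, if_true, norm_mul, mul_pow,
        Complex.norm_natCast]
      field_simp
    rw [h4]
    exact h1.mul_left _
  · intro m hm
    rw [if_neg]
    · simp
    · rintro ⟨n, rfl⟩
      exact hm ⟨n, rfl⟩

/-- By Parseval, the left side sums |f̂|² over the multiples of r and the right side sums it over
all integers. -/
theorem integral_periodize_sq_le (hr : 0 < r) {f : UnitAddCircle → ℂ}
    (hf : MemLp f 2 haarAddCircle) :
    (r : ℝ)⁻¹ ^ 2 * ∫ t, ‖periodize r f t‖ ^ 2 ∂haarAddCircle ≤ ∫ t, ‖f t‖ ^ 2 ∂haarAddCircle := by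
  have h1 := hasSum_sq_fourierCoeff_mul hr hf
  have h2 := hasSum_sq_fourierCoeff_mul (r := 1) Nat.one_pos hf
  have h3 : periodize 1 f = f := funext fun t => by simp [periodize]
  simp only [h3, Nat.cast_one, one_mul, inv_one, one_pow] at h2
  have hinj : Function.Injective fun n : ℤ => (r : ℤ) * n :=
    mul_right_injective₀ (by exact_mod_cast hr.ne')
  refine hasSum_le_inj (f := fun n : ℤ => ‖fourierCoeff f (r * n)‖ ^ 2)
    (g := fun n : ℤ => ‖fourierCoeff f n‖ ^ 2) (fun n : ℤ => (r : ℤ) * n) hinj ?_ ?_ h1 h2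
  · exact fun _ _ => sq_nonneg _
  · exact fun n => le_refl (‖fourierCoeff f (r * n)‖ ^ 2)

end Periodization

/-! ### Almost everywhere statements on the circle and on (0, 1/r) -/

section AlmostEverywhere

theorem ae_haarAddCircle_iff {P : UnitAddCircle → Prop} :
    (∀ᵐ t ∂(haarAddCircle : Measure UnitAddCircle), P t) ↔
      ∀ᵐ x : ℝ ∂volume.restrict (Set.Ioc 0 1), P x := by
  have h0 : (haarAddCircle : Measure UnitAddCircle) = volume := by
    rw [volume_eq_smul_haarAddCircle]; simp
  rw [h0]
  have hmp := measurePreserving_equivIoc (T := (1 : ℝ)) (a := 0)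
  constructor
  · intro h
    have h1 := (UnitAddCircle.measurePreserving_mk 0).quasiMeasurePreserving.ae h
    simpa using h1
  · intro h
    have h1 : ∀ᵐ x : ℝ ∂volume.restrict (Set.Ioc 0 (0 + 1)), P x := by simpa only [zero_add] using h
    rw [ae_restrict_iff_subtype measurableSet_Ioc] at h1
    have h2 := hmp.quasiMeasurePreserving.ae h1
    filter_upwards [h2] with t ht
    have : ((equivIoc (1 : ℝ) 0 t : ℝ) : UnitAddCircle) = t :=
      (equivIoc (1 : ℝ) 0).symm_apply_apply t
    rwa [this] at ht

theorem iff_of_periodic {r : ℕ} {P : UnitAddCircle → Prop}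
    (hP : ∀ t, P (t + ((1 / r : ℝ) : UnitAddCircle)) ↔ P t) (n : ℕ) (t : UnitAddCircle) :
    P (t + ((n / r : ℝ) : UnitAddCircle)) ↔ P t := by
  induction n generalizing t with
  | zero => simp
  | succ n ih =>
    rw [← ih t, ← hP (t + ((n / r : ℝ) : UnitAddCircle)), add_assoc, ← AddCircle.coe_add]
    have : ((n + 1 : ℕ) / r : ℝ) = n / r + 1 / r := by push_cast; ring
    rw [this]

/-- Up to a null set, (0, 1/r) is a fundamental domain for translation by 1/r. This carries the
essential bounds in α_G and β_G to the circle. -/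
theorem ae_haarAddCircle_iff_of_periodic {r : ℕ} (hr : 0 < r) {P : UnitAddCircle → Prop}
    (hP : ∀ t, P (t + ((1 / r : ℝ) : UnitAddCircle)) ↔ P t) :
    (∀ᵐ t ∂(haarAddCircle : Measure UnitAddCircle), P t) ↔
      ∀ᵐ x : ℝ ∂volume.restrict (Set.Ioo 0 (1 / (r : ℝ))), P x := by
  have hr0 : (0 : ℝ) < r := by exact_mod_cast hr
  rw [ae_haarAddCircle_iff]
  constructor
  · intro h
    refine ae_mono (Measure.restrict_mono ?_ le_rfl) h
    intro x hx
    refine ⟨hx.1, hx.2.le.trans ?_⟩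
    rw [div_le_one hr0]
    exact_mod_cast hr
  · intro h
    have hnat := iff_of_periodic hP
    rw [Measure.restrict_congr_set Ioo_ae_eq_Ico, ae_restrict_iff' measurableSet_Ico] at h
    rw [ae_restrict_iff' measurableSet_Ioc]
    have h1 : ∀ᵐ x : ℝ, ∀ n : ℕ, x + (-(n / r : ℝ)) ∈ Set.Ico 0 (1 / (r : ℝ)) →
        P ((x + (-(n / r : ℝ)) : ℝ) : UnitAddCircle) :=
      ae_all_iff.2 fun n =>
        (measurePreserving_add_right volume (-(n / r : ℝ))).quasiMeasurePreserving.ae h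
    filter_upwards [h1] with x hx hx1
    -- Subtracting ⌊rx⌋/r brings x into [0, 1/r); the half-open interval is what makes the
    -- translates tile.
    have h2 := hx ⌊r * x⌋₊ ?_
    · rw [← hnat ⌊r * x⌋₊, ← AddCircle.coe_add] at h2
      simpa using h2
    · have h3 := Nat.floor_le (mul_nonneg hr0.le hx1.1.le)
      have h4 := Nat.lt_floor_add_one (r * x)
      constructor
      · rw [← sub_eq_add_neg, sub_nonneg, div_le_iff₀ hr0]; linarith
      · rw [← sub_eq_add_neg, sub_lt_iff_lt_add, ← add_div, lt_div_iff₀ hr0]; linarith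

end AlmostEverywhere

/-! ### Extreme eigenvalues of M*M -/

section Eigenvalues

variable {s r : ℕ} (M : Matrix (Fin s) (Fin r) ℂ)

theorem norm_sq_sum_mul_le {ι : Type*} (S : Finset ι) (f g : ι → ℂ) :
    ‖∑ k ∈ S, f k * g k‖ ^ 2 ≤ (∑ k ∈ S, ‖f k‖ ^ 2) * ∑ k ∈ S, ‖g k‖ ^ 2 := by
  refine le_trans ?_ (Finset.sum_mul_sq_le_sq_mul_sq S (fun k => ‖f k‖) fun k => ‖g k‖)
  gcongr
  exact (norm_sum_le _ _).trans_eq (by simp)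

/-- The quadratic form ‖Mv‖² = ⟨M*Mv, v⟩, diagonalized in an orthonormal eigenbasis of M*M. All the
eigenvalue estimates below rest on it. -/
theorem sum_norm_sq_mulVec_eq (v : Fin r → ℂ) :
    ∑ j, ‖(M *ᵥ v) j‖ ^ 2 = ∑ i, (Matrix.isHermitian_conjTranspose_mul_self M).eigenvalues i *
      ‖inner ℂ ((Matrix.isHermitian_conjTranspose_mul_self M).eigenvectorBasis i)
        (WithLp.toLp 2 v : EuclideanSpace ℂ (Fin r))‖ ^ 2 := by
  set hH := Matrix.isHermitian_conjTranspose_mul_self M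
  set x : EuclideanSpace ℂ (Fin r) := WithLp.toLp 2 v
  set y : EuclideanSpace ℂ (Fin r) := WithLp.toLp 2 ((Mᴴ * M) *ᵥ v)
  have h1 : (inner ℂ x y : ℂ) = ((∑ j, ‖(M *ᵥ v) j‖ ^ 2 : ℝ) : ℂ) := by
    have h2 : (inner ℂ x y : ℂ) = ((Mᴴ * M) *ᵥ v) ⬝ᵥ star v := rfl
    rw [h2, dotProduct_comm, ← Matrix.mulVec_mulVec, Matrix.dotProduct_mulVec,
      Matrix.vecMul_conjTranspose, star_star]
    simp only [dotProduct, Pi.star_apply, RCLike.star_def, RCLike.conj_mul]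
    push_cast
    rfl
  have h3 : ∀ i, (inner ℂ (hH.eigenvectorBasis i) y : ℂ) =
      hH.eigenvalues i * inner ℂ (hH.eigenvectorBasis i) x := fun i => by
    have h2 : (inner ℂ (hH.eigenvectorBasis i) y : ℂ) =
      ((Mᴴ * M) *ᵥ v) ⬝ᵥ star (hH.eigenvectorBasis i).ofLp := rfl
    have h4 : (inner ℂ (hH.eigenvectorBasis i) x : ℂ) =
      v ⬝ᵥ star (hH.eigenvectorBasis i).ofLp := rfl
    have h5 := hH.mulVec_eigenvectorBasis i
    rw [h2, h4, dotProduct_comm, Matrix.dotProduct_mulVec]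
    have h6 : star (hH.eigenvectorBasis i).ofLp ᵥ* (Mᴴ * M) =
        (hH.eigenvalues i : ℂ) • star (hH.eigenvectorBasis i).ofLp := by
      have h7 := congrArg star h5
      rw [Matrix.star_mulVec, hH.eq] at h7
      rw [h7]
      ext k
      simp
    rw [h6, smul_dotProduct, dotProduct_comm v, smul_eq_mul]
  have h4 := hH.eigenvectorBasis.sum_inner_mul_inner x y
  rw [h1] at h4
  have h5 : ((∑ j, ‖(M *ᵥ v) j‖ ^ 2 : ℝ) : ℂ) = ((∑ i, hH.eigenvalues i *
      ‖inner ℂ (hH.eigenvectorBasis i) x‖ ^ 2 : ℝ) : ℂ) := by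
    rw [← h4]
    push_cast
    refine Finset.sum_congr rfl fun i _ => ?_
    rw [h3, mul_left_comm, ← inner_conj_symm, RCLike.conj_mul]
    rfl
  exact_mod_cast h5

theorem sum_norm_sq_eq (v : Fin r → ℂ) :
    ∑ k, ‖v k‖ ^ 2 = ∑ i,
      ‖inner ℂ ((Matrix.isHermitian_conjTranspose_mul_self M).eigenvectorBasis i)
        (WithLp.toLp 2 v : EuclideanSpace ℂ (Fin r))‖ ^ 2 := by
  rw [OrthonormalBasis.sum_sq_norm_inner_right, EuclideanSpace.norm_sq_eq]

theorem eigenvalues_eq_sum (i : Fin r) :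
    (Matrix.isHermitian_conjTranspose_mul_self M).eigenvalues i = ∑ j, ‖(M *ᵥ
      ((Matrix.isHermitian_conjTranspose_mul_self M).eigenvectorBasis i).ofLp) j‖ ^ 2 := by
  rw [sum_norm_sq_mulVec_eq]
  set b := (Matrix.isHermitian_conjTranspose_mul_self M).eigenvectorBasis
  have h : ∀ k, (inner ℂ (b k) (WithLp.toLp 2 (b i).ofLp : EuclideanSpace ℂ (Fin r)) : ℂ) =
      if k = i then 1 else 0 := fun k => orthonormal_iff_ite.1 b.orthonormal k i
  rw [Finset.sum_eq_single i (fun k _ hk => by simp [h, hk]) (by simp), h]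
  simp

theorem sum_norm_sq_eigenvectorBasis (i : Fin r) :
    ∑ k, ‖((Matrix.isHermitian_conjTranspose_mul_self M).eigenvectorBasis i).ofLp k‖ ^ 2 = 1 := by
  rw [← EuclideanSpace.norm_sq_eq]
  simp

theorem lambdaMin_mul_le (v : Fin r → ℂ) :
    lambdaMin M * ∑ k, ‖v k‖ ^ 2 ≤ ∑ j, ‖(M *ᵥ v) j‖ ^ 2 := by
  rw [sum_norm_sq_mulVec_eq, sum_norm_sq_eq M, Finset.mul_sum]
  gcongr with i
  exact ciInf_le (Set.finite_range _).bddBelow i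

theorem le_lambdaMin (hr : 0 < r) {A : ℝ}
    (h : ∀ v : Fin r → ℂ, A * ∑ k, ‖v k‖ ^ 2 ≤ ∑ j, ‖(M *ᵥ v) j‖ ^ 2) : A ≤ lambdaMin M := by
  have : Nonempty (Fin r) := ⟨⟨0, hr⟩⟩
  refine le_ciInf fun i => ?_
  rw [eigenvalues_eq_sum]
  refine le_trans ?_ (h _)
  rw [sum_norm_sq_eigenvectorBasis, mul_one]

theorem norm_sq_entry_le_lambdaMax (j : Fin s) (k : Fin r) : ‖M j k‖ ^ 2 ≤ lambdaMax M := by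
  have h1 : ∑ j, ‖(M *ᵥ Pi.single k 1) j‖ ^ 2 ≤
      lambdaMax M * ∑ l, ‖(Pi.single k 1 : Fin r → ℂ) l‖ ^ 2 := by
    rw [sum_norm_sq_mulVec_eq, sum_norm_sq_eq M, Finset.mul_sum]
    gcongr with i
    exact le_ciSup (f := (Matrix.isHermitian_conjTranspose_mul_self M).eigenvalues)
      (Set.finite_range _).bddAbove i
  have h2 : ∑ l, ‖(Pi.single k 1 : Fin r → ℂ) l‖ ^ 2 = 1 := by
    rw [Finset.sum_eq_single k] <;> simp +contextual
  rw [h2, mul_one] at h1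
  refine le_trans ?_ h1
  have h3 := Finset.single_le_sum (f := fun j => ‖(M *ᵥ Pi.single k 1) j‖ ^ 2)
    (fun _ _ => sq_nonneg _) (Finset.mem_univ j)
  simpa using h3

/-- Each eigenvalue is ‖Mw‖² for a unit eigenvector w, and Cauchy–Schwarz is applied to each row. -/
theorem lambdaMax_le (hr : 0 < r) : lambdaMax M ≤ ∑ k, ∑ j, ‖M j k‖ ^ 2 := by
  have : Nonempty (Fin r) := ⟨⟨0, hr⟩⟩
  refine ciSup_le fun i => ?_
  rw [eigenvalues_eq_sum, Finset.sum_comm]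
  gcongr with j
  refine (norm_sq_sum_mul_le _ _ _).trans_eq ?_
  rw [sum_norm_sq_eigenvectorBasis, mul_one]

end Eigenvalues

/-! ### The constants α_G and β_G in terms of real bounds -/

section Symbols

variable {s r : ℕ} {g : Fin s → UnitAddCircle → ℂ}

/-- The squared Hilbert–Schmidt norm of G(x) is a 1/r-periodic function on the circle, so bounding
it on (0, 1/r) bounds it everywhere. -/
theorem sum_norm_sq_symbolMatrix (x : ℝ) :
    ∑ k, ∑ j, ‖symbolMatrix r g x j k‖ ^ 2 = periodize r (fun t => ∑ j, ‖g j t‖ ^ 2) x := by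
  rw [periodize, ← Fin.sum_univ_eq_sum_range
    (fun k : ℕ => ∑ j, ‖g j ((x : UnitAddCircle) + ((k / r : ℝ) : UnitAddCircle))‖ ^ 2)]
  simp [symbolMatrix]

theorem ae_translate {P : UnitAddCircle → Prop}
    (h : ∀ᵐ t ∂(haarAddCircle : Measure UnitAddCircle), P t) (c : UnitAddCircle) :
    ∀ᵐ t ∂(haarAddCircle : Measure UnitAddCircle), P (t + c) :=
  (measurePreserving_add_right haarAddCircle c).quasiMeasurePreserving.ae h

theorem exists_norm_le_of_memLp_top {f : UnitAddCircle → ℂ} (hf : MemLp f ∞ haarAddCircle) :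
    ∃ C : ℝ, ∀ᵐ t ∂(haarAddCircle : Measure UnitAddCircle), ‖f t‖ ≤ C := by
  have h1 : eLpNormEssSup f haarAddCircle < ∞ := by
    simpa using hf.eLpNorm_lt_top
  refine ⟨(eLpNormEssSup f haarAddCircle).toReal, ?_⟩
  filter_upwards [ae_le_eLpNormEssSup (f := f)] with t ht
  have h2 := ENNReal.toReal_mono h1.ne ht
  simpa using h2

/-- The entries are essentially bounded if and only if `β_G` is finite. -/
theorem memLp_top_iff_betaG_lt_top (hr : 0 < r)
    (hg : ∀ j, AEStronglyMeasurable (g j) haarAddCircle) :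
    (∀ j, MemLp (g j) ∞ haarAddCircle) ↔ betaG r g < ∞ := by
  have hper : ∀ C : ℝ, (∀ᵐ t ∂(haarAddCircle : Measure UnitAddCircle),
      periodize r (fun t => ∑ j, ‖g j t‖ ^ 2) t ≤ C) ↔
      ∀ᵐ x : ℝ ∂volume.restrict (Set.Ioo 0 (1 / (r : ℝ))),
        ∑ k, ∑ j, ‖symbolMatrix r g x j k‖ ^ 2 ≤ C := fun C => by
    simp only [sum_norm_sq_symbolMatrix]
    exact ae_haarAddCircle_iff_of_periodic hr fun t => by rw [periodize_add hr]
  constructor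
  · intro h
    have h1 : ∀ j, ∃ C : ℝ, ∀ᵐ t ∂(haarAddCircle : Measure UnitAddCircle), ‖g j t‖ ≤ C :=
      fun j => exists_norm_le_of_memLp_top (h j)
    choose C hC using h1
    have h2 : ∀ᵐ t ∂(haarAddCircle : Measure UnitAddCircle),
        periodize r (fun t => ∑ j, ‖g j t‖ ^ 2) t ≤ ∑ k ∈ Finset.range r, ∑ j, C j ^ 2 := by
      have h3 : ∀ᵐ t ∂(haarAddCircle : Measure UnitAddCircle), ∀ (k : ℕ) (j : Fin s),
          ‖g j (t + ((k / r : ℝ) : UnitAddCircle))‖ ≤ C j := by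
        refine ae_all_iff.2 fun k => ae_all_iff.2 fun j => ?_
        exact ae_translate (hC j) _
      filter_upwards [h3] with t ht
      unfold periodize
      refine Finset.sum_le_sum fun k _ => Finset.sum_le_sum fun j _ => ?_
      gcongr
      exact ht k j
    rw [hper] at h2
    unfold betaG
    refine lt_of_le_of_lt (essSup_le_of_ae_le _ ?_)
      (ENNReal.ofReal_lt_top (r := ∑ k ∈ Finset.range r, ∑ j, C j ^ 2))
    filter_upwards [h2] with x hx
    exact ENNReal.ofReal_le_ofReal ((lambdaMax_le _ hr).trans hx)
  · intro h j
    have h1 : ∀ᵐ x : ℝ ∂volume.restrict (Set.Ioo 0 (1 / (r : ℝ))),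
        ∑ k, ∑ j, ‖symbolMatrix r g x j k‖ ^ 2 ≤ ∑ _k : Fin r, ∑ _j : Fin s, (betaG r g).toReal := by
      filter_upwards [ENNReal.ae_le_essSup fun x : ℝ =>
        ENNReal.ofReal (lambdaMax (symbolMatrix r g x))] with x hx
      gcongr with k _ j
      refine (norm_sq_entry_le_lambdaMax _ _ _).trans ?_
      rwa [← ENNReal.ofReal_le_iff_le_toReal h.ne]
    rw [← hper] at h1
    refine memLp_top_of_bound (hg j) (Real.sqrt (∑ _k : Fin r, ∑ _j : Fin s, (betaG r g).toReal)) ?_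
    filter_upwards [h1] with t ht
    refine Real.le_sqrt_of_sq_le (le_trans ?_ ht)
    refine le_trans ?_ (single_le_periodize hr (fun t => Finset.sum_nonneg fun _ _ => sq_nonneg _) t)
    exact Finset.single_le_sum (f := fun j => ‖g j t‖ ^ 2) (fun _ _ => sq_nonneg _)
      (Finset.mem_univ j)

theorem alphaG_pos_iff : 0 < alphaG r g ↔ ∃ A : ℝ, 0 < A ∧
    ∀ᵐ x : ℝ ∂volume.restrict (Set.Ioo 0 (1 / (r : ℝ))), A ≤ lambdaMin (symbolMatrix r g x) := by
  constructor
  · intro h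
    -- Truncating at 1 yields a finite constant without having to show that α_G is finite.
    have h0 : min (alphaG r g) 1 ≠ ∞ := ne_top_of_le_ne_top ENNReal.one_ne_top (min_le_right _ _)
    have h1 : 0 < min (alphaG r g) 1 := lt_min h one_pos
    refine ⟨(min (alphaG r g) 1).toReal, ENNReal.toReal_pos h1.ne' h0, ?_⟩
    filter_upwards [ae_essInf_le (f := fun x : ℝ =>
      ENNReal.ofReal (lambdaMin (symbolMatrix r g x)))] with x hx
    have h2 := (min_le_left (alphaG r g) 1).trans hx
    by_contra! hlt
    have h3 := (ENNReal.ofReal_lt_ofReal_iff (ENNReal.toReal_pos h1.ne' h0)).2 hlt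
    rw [ENNReal.ofReal_toReal h0] at h3
    exact absurd h2 (not_le.2 h3)
  · rintro ⟨A, hA, h⟩
    refine lt_of_lt_of_le (ENNReal.ofReal_pos.2 hA) (le_essInf_of_ae_le _ ?_)
    filter_upwards [h] with x hx
    exact ENNReal.ofReal_le_ofReal hx

end Symbols

/-! ### Positivity of α_G as an integral inequality -/

section LowerBound

variable {s r : ℕ} {g : Fin s → UnitAddCircle → ℂ}

theorem symbolMatrix_mulVec (F : UnitAddCircle → ℂ) (x : ℝ) (j : Fin s) :
    (symbolMatrix r g x *ᵥ fun k => F ((x : UnitAddCircle) + ((k / r : ℝ) : UnitAddCircle))) j =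
      periodize r (fun t => g j t * F t) x := by
  rw [periodize, ← Fin.sum_univ_eq_sum_range (fun k : ℕ =>
    g j ((x : UnitAddCircle) + ((k / r : ℝ) : UnitAddCircle)) *
      F ((x : UnitAddCircle) + ((k / r : ℝ) : UnitAddCircle)))]
  simp [symbolMatrix, Matrix.mulVec, dotProduct]

theorem sum_norm_sq_translates (F : UnitAddCircle → ℂ) (x : UnitAddCircle) :
    ∑ k : Fin r, ‖F (x + ((k / r : ℝ) : UnitAddCircle))‖ ^ 2 =
      periodize r (fun t => ‖F t‖ ^ 2) x := by
  rw [periodize, ← Fin.sum_univ_eq_sum_range (fun k : ℕ =>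
    ‖F (x + ((k / r : ℝ) : UnitAddCircle))‖ ^ 2)]

/-- This permits an integral inequality for periodizations to be localized to any 1/r-periodic
measurable set. -/
theorem periodize_indicator {M : Type*} [AddCommMonoid M] {E : Set UnitAddCircle}
    (hE : ∀ t, t + ((1 / r : ℝ) : UnitAddCircle) ∈ E ↔ t ∈ E) (f : UnitAddCircle → M) :
    periodize r (E.indicator f) = E.indicator (periodize r f) := by
  classical
  funext t
  have h := iff_of_periodic hE
  by_cases ht : t ∈ E
  · rw [Set.indicator_of_mem ht]
    exact Finset.sum_congr rfl fun k _ => Set.indicator_of_mem ((h k t).2 ht) _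
  · rw [Set.indicator_of_notMem ht]
    exact Finset.sum_eq_zero fun k _ => Set.indicator_of_notMem (mt (h k t).1 ht) _

/-- The function on the circle that takes the value `v k` on `[k / r, (k + 1) / r)`. -/
noncomputable def stepFunction (v : Fin r → ℂ) (t : UnitAddCircle) : ℂ :=
  if h : ⌊(r : ℝ) * (measurableEquivIco (1 : ℝ) 0 t : ℝ)⌋₊ < r then v ⟨_, h⟩ else 0

theorem measurable_stepFunction (v : Fin r → ℂ) : Measurable (stepFunction v) := by
  have h1 : Measurable fun n : ℕ => if h : n < r then v ⟨n, h⟩ else 0 := measurable_from_nat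
  have h2 : Measurable fun t : UnitAddCircle => ⌊(r : ℝ) * (measurableEquivIco (1 : ℝ) 0 t : ℝ)⌋₊ :=
    Nat.measurable_floor.comp
      ((measurable_subtype_coe.comp (measurableEquivIco (1 : ℝ) 0).measurable).const_mul _)
  exact h1.comp h2

theorem memLp_stepFunction (v : Fin r → ℂ) : MemLp (stepFunction v) 2 haarAddCircle := by
  refine MemLp.of_bound (measurable_stepFunction v).aestronglyMeasurable (∑ k, ‖v k‖)
    (Filter.Eventually.of_forall fun t => ?_)
  unfold stepFunction
  split_ifs with h
  · exact Finset.single_le_sum (f := fun k => ‖v k‖) (fun _ _ => norm_nonneg _)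
      (Finset.mem_univ _)
  · rw [norm_zero]
    exact Finset.sum_nonneg fun _ _ => norm_nonneg _

theorem stepFunction_apply (hr : 0 < r) (v : Fin r → ℂ) {x : ℝ}
    (hx : x ∈ Set.Ioo 0 (1 / (r : ℝ))) (k : Fin r) :
    stepFunction v ((x : UnitAddCircle) + ((k / r : ℝ) : UnitAddCircle)) = v k := by
  have hr0 : (0 : ℝ) < r := by exact_mod_cast hr
  have hk : (k : ℝ) + 1 ≤ r := by exact_mod_cast k.2
  have hx2 : x * r < 1 := (lt_div_iff₀ hr0).1 hx.2
  have h1 : x + k / r ∈ Set.Ico (0 : ℝ) (0 + 1) := by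
    refine ⟨by have := hx.1; positivity, ?_⟩
    have : x + k / r = (x * r + k) / r := by field_simp
    rw [this, zero_add, div_lt_one hr0]
    linarith
  have h2 : (measurableEquivIco (1 : ℝ) 0 ((x + k / r : ℝ) : UnitAddCircle) : ℝ) = x + k / r := by
    have h3 := (equivIco (1 : ℝ) 0).apply_symm_apply ⟨x + k / r, h1⟩
    exact congrArg Subtype.val h3
  have h3 : ⌊(r : ℝ) * (x + k / r)⌋₊ = k := by
    have : (r : ℝ) * (x + k / r) = x * r + k := by field_simp
    rw [this, Nat.floor_add_natCast (by have := hx.1; positivity)]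
    have : ⌊x * r⌋₊ = 0 := Nat.floor_eq_zero.2 hx2
    omega
  unfold stepFunction
  rw [← AddCircle.coe_add]
  simp only [h2, h3]
  simp

/-- At a point x the integrand on the right is ‖G(x)w‖², where w is the vector of translates of F.
Forwards, the eigenvalue bound is integrated over the circle. Backwards, F is taken with constant
translates v and cut off to the periodic set where the pointwise inequality fails, which must then
be null. -/
theorem alphaG_pos_iff_integral (hr : 0 < r) (hgm : ∀ j, Measurable (g j))
    (hg : ∀ j, MemLp (g j) ∞ haarAddCircle) :
    0 < alphaG r g ↔ ∃ A : ℝ, 0 < A ∧ ∀ F : UnitAddCircle → ℂ, MemLp F 2 haarAddCircle →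
      A * ∫ t, ‖F t‖ ^ 2 ∂haarAddCircle ≤
        ∑ j, ∫ t, ‖periodize r (fun t => g j t * F t) t‖ ^ 2 ∂haarAddCircle := by
  have hr0 : (0 : ℝ) < r := by exact_mod_cast hr
  have hmul : ∀ F : UnitAddCircle → ℂ, MemLp F 2 haarAddCircle → ∀ j,
      MemLp (fun t => g j t * F t) 2 haarAddCircle := fun F hF j => hF.mul (hg j)
  have hint1 : ∀ F : UnitAddCircle → ℂ, MemLp F 2 haarAddCircle → ∀ j, Integrable
      (fun t => ‖periodize r (fun t => g j t * F t) t‖ ^ 2) haarAddCircle := fun F hF j =>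
    (memLp_periodize (hmul F hF j)).integrable_norm_pow (by norm_num)
  have hint2 : ∀ F : UnitAddCircle → ℂ, MemLp F 2 haarAddCircle →
      Integrable (fun t => ‖F t‖ ^ 2) haarAddCircle := fun F hF =>
    hF.integrable_norm_pow (by norm_num)
  rw [alphaG_pos_iff]
  constructor
  · rintro ⟨A, hA, h⟩
    -- The factor r arises because periodization multiplies the integral by r.
    refine ⟨A * r, by positivity, fun F hF => ?_⟩
    have h1 : ∀ᵐ t ∂(haarAddCircle : Measure UnitAddCircle),
        A * periodize r (fun t => ‖F t‖ ^ 2) t ≤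
          ∑ j, ‖periodize r (fun t => g j t * F t) t‖ ^ 2 := by
      rw [ae_haarAddCircle_iff_of_periodic hr fun t => by simp only [periodize_add hr]]
      filter_upwards [h] with x hx
      rw [← sum_norm_sq_translates]
      simp only [← symbolMatrix_mulVec]
      refine le_trans ?_ (lambdaMin_mul_le _ _)
      gcongr
    have h2 := integral_mono_ae ((integrable_periodize (r := r) (hint2 F hF)).const_mul A)
      (integrable_finsetSum _ fun j _ => hint1 F hF j) h1
    rw [integral_const_mul, integral_periodize (hint2 F hF),
      integral_finsetSum _ fun j _ => hint1 F hF j, ← mul_assoc] at h2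
    exact h2
  · rintro ⟨A, hA, h⟩
    refine ⟨A / r, by positivity, ?_⟩
    have key : ∀ v : Fin r → ℂ, ∀ᵐ x : ℝ ∂volume.restrict (Set.Ioo 0 (1 / (r : ℝ))),
        A / r * ∑ k, ‖v k‖ ^ 2 ≤ ∑ j, ‖(symbolMatrix r g x *ᵥ v) j‖ ^ 2 := by
      intro v
      -- For every x in (0, 1/r) the translates of this ψ are the coordinates of v.
      set ψ := stepFunction v with hψ
      have hψL : MemLp ψ 2 haarAddCircle := memLp_stepFunction v
      have hψm : Measurable ψ := measurable_stepFunction v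
      set q : UnitAddCircle → ℝ := fun t => ∑ j, ‖periodize r (fun t => g j t * ψ t) t‖ ^ 2 -
        A / r * periodize r (fun t => ‖ψ t‖ ^ 2) t with hq
      have hqper : ∀ t, q (t + ((1 / r : ℝ) : UnitAddCircle)) = q t := fun t => by
        simp only [hq, periodize_add hr]
      have hqm : Measurable q :=
        (Finset.measurable_fun_sum _ fun j _ =>
          (measurable_periodize ((hgm j).mul hψm)).norm.pow_const 2).sub
          ((measurable_periodize_real (hψm.norm.pow_const 2)).const_mul _)
      have hqi : Integrable q haarAddCircle :=
        (integrable_finsetSum _ fun j _ => hint1 ψ hψL j).sub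
          ((integrable_periodize (hint2 ψ hψL)).const_mul _)
      -- Testing with the cut-off of ψ to this bad set gives ∫_E q ≥ 0 although q < 0 on E, so E is
      -- null.
      set E : Set UnitAddCircle := {t | q t < 0} with hE
      have hEm : MeasurableSet E := measurableSet_lt hqm measurable_const
      have hEper : ∀ t, t + ((1 / r : ℝ) : UnitAddCircle) ∈ E ↔ t ∈ E := fun t => by
        simp only [hE, Set.mem_ofPred_eq, hqper]
      have hF : MemLp (E.indicator ψ) 2 haarAddCircle := hψL.indicator hEm
      have h1 := h _ hF
      have e1 : ∀ j, (fun t => ‖periodize r (fun t => g j t * E.indicator ψ t) t‖ ^ 2) =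
          E.indicator fun t => ‖periodize r (fun t => g j t * ψ t) t‖ ^ 2 := fun j => by
        have e2 : (fun t => g j t * E.indicator ψ t) = E.indicator fun t => g j t * ψ t := by
          funext t
          by_cases ht : t ∈ E <;> simp [ht]
        rw [e2, periodize_indicator hEper]
        funext t
        by_cases ht : t ∈ E <;> simp [ht]
      have e3 : (fun t => ‖E.indicator ψ t‖ ^ 2) = E.indicator fun t => ‖ψ t‖ ^ 2 := by
        funext t
        by_cases ht : t ∈ E <;> simp [ht]
      have e4 : ∫ t, E.indicator (periodize r fun t => ‖ψ t‖ ^ 2) t ∂haarAddCircle =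
          r * ∫ t, ‖E.indicator ψ t‖ ^ 2 ∂haarAddCircle := by
        rw [← integral_periodize (hint2 _ hF), e3, periodize_indicator hEper]
      have e5 : ∫ t, E.indicator q t ∂haarAddCircle =
          ∑ j, ∫ t, ‖periodize r (fun t => g j t * E.indicator ψ t) t‖ ^ 2 ∂haarAddCircle -
            A * ∫ t, ‖E.indicator ψ t‖ ^ 2 ∂haarAddCircle := by
        have e6 : E.indicator q = fun t =>
            ∑ j, ‖periodize r (fun t => g j t * E.indicator ψ t) t‖ ^ 2 -
              A / r * E.indicator (periodize r fun t => ‖ψ t‖ ^ 2) t := by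
          funext t
          simp only [fun j => congrFun (e1 j) t]
          by_cases ht : t ∈ E <;> simp [ht, hq]
        rw [e6, integral_sub (integrable_finsetSum _ fun j _ => hint1 _ hF j)
          (((integrable_periodize (hint2 ψ hψL)).indicator hEm).const_mul _),
          integral_finsetSum _ fun j _ => hint1 _ hF j, integral_const_mul, e4]
        congr 1
        field_simp
      have h2 : 0 ≤ ∫ t, E.indicator q t ∂haarAddCircle := by rw [e5]; linarith
      have h3 : 0 ≤ fun t => -E.indicator q t := fun t => by
        by_cases ht : t ∈ E
        · simpa [ht] using le_of_lt ht
        · simp [ht]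
      have h4 : ∫ t, -E.indicator q t ∂haarAddCircle = 0 := by
        refine le_antisymm ?_ (integral_nonneg h3)
        rw [integral_neg]; linarith
      rw [integral_eq_zero_iff_of_nonneg h3 (hqi.indicator hEm).neg] at h4
      have h5 : ∀ᵐ t ∂(haarAddCircle : Measure UnitAddCircle), 0 ≤ q t := by
        filter_upwards [h4] with t ht
        by_contra! hlt
        have hmem : t ∈ E := hlt
        simp only [Set.indicator_of_mem hmem, Pi.zero_apply, neg_eq_zero] at ht
        exact hlt.ne ht
      rw [ae_haarAddCircle_iff_of_periodic hr fun t => by rw [hqper]] at h5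
      filter_upwards [h5, ae_restrict_mem measurableSet_Ioo] with x hx hxm
      have e7 : (fun k : Fin r => ψ ((x : UnitAddCircle) + ((k / r : ℝ) : UnitAddCircle))) = v :=
        funext fun k => stepFunction_apply hr v hxm k
      have e8 := sub_nonneg.1 hx
      rw [← sum_norm_sq_translates] at e8
      simp only [← symbolMatrix_mulVec, e7] at e8
      simpa only [fun k => congrFun e7 k] using e8
    -- The null set in `key` depends on v. A countable dense set of vectors gives a common one, and
    -- continuity in v covers the rest.
    have h1 := ae_all_iff.2 fun n => key (TopologicalSpace.denseSeq (Fin r → ℂ) n)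
    filter_upwards [h1] with x hx
    refine le_lambdaMin _ hr fun v => ?_
    refine isClosed_property (p := fun v => A / r * ∑ k, ‖v k‖ ^ 2 ≤
      ∑ j, ‖(symbolMatrix r g x *ᵥ v) j‖ ^ 2)
      (TopologicalSpace.denseRange_denseSeq (Fin r → ℂ)) ?_ hx v
    refine isClosed_le (by fun_prop) ?_
    refine continuous_finsetSum _ fun j _ => ?_
    simp only [Matrix.mulVec, dotProduct]
    fun_prop

end LowerBound

/-! ### Sampling in the orbit span of a single unitary operator -/

section Sampling

variable {H : Type*} [NormedAddCommGroup H] [InnerProductSpace ℂ H] (U : H ≃ₗᵢ[ℂ] H)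

theorem unitaryPow_apply (n : ℤ) (x : H) : unitaryPow U n x = (U ^ n) x := rfl

theorem unitaryPow_add (m n : ℤ) (x : H) :
    unitaryPow U (m + n) x = unitaryPow U m (unitaryPow U n x) := by
  simp only [unitaryPow_apply, zpow_add]
  rfl

theorem unitaryPow_zero (x : H) : unitaryPow U 0 x = x := by
  simp [unitaryPow_apply]

theorem inner_unitaryPow (n : ℤ) (x y : H) :
    (inner ℂ (unitaryPow U n x) (unitaryPow U n y) : ℂ) = inner ℂ x y :=
  (U ^ n : H ≃ₗᵢ[ℂ] H).inner_map_map x y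

theorem inner_unitaryPow_sub (m n : ℤ) (x y : H) :
    (inner ℂ (unitaryPow U m x) (unitaryPow U n y) : ℂ) = inner ℂ (unitaryPow U (m - n) x) y := by
  rw [← inner_unitaryPow U n (unitaryPow U (m - n) x), ← unitaryPow_add, add_sub_cancel]

/-- The closed span of the orbit of `a`. -/
abbrev orbitSpan (a : H) : Submodule ℂ H := closedSpan fun n : ℤ => unitaryPow U n a

theorem unitaryPow_mem_orbitSpan_iff (a : H) (n : ℤ) (x : H) :
    unitaryPow U n x ∈ orbitSpan U a ↔ x ∈ orbitSpan U a := by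
  have h : ∀ (n : ℤ) (x : H), x ∈ orbitSpan U a → unitaryPow U n x ∈ orbitSpan U a :=
    fun n x hx => map_mem_of_mem_closedSpan (unitaryPow U n) (isClosed_closedSpan _)
      (fun i => by
        rw [← unitaryPow_add]
        exact mem_closedSpan (fun n : ℤ => unitaryPow U n a) (n + i)) hx
  refine ⟨fun hx => ?_, h n x⟩
  have h1 := h (-n) _ hx
  rwa [← unitaryPow_add, neg_add_cancel, unitaryPow_zero] at h1

variable {U} {a : H}

/-- The bounded isomorphism of `L²(0,1)` onto the closed span of the orbit. -/
theorem exists_fourier_synthesis (ha : IsRieszSequence fun n : ℤ => unitaryPow U n a) :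
    ∃ τ : Lp ℂ 2 (haarAddCircle (T := (1 : ℝ))) →L[ℂ] H,
      (∀ n : ℤ, τ (fourierLp 2 n) = unitaryPow U n a) ∧
      (∃ c : ℝ, 0 < c ∧ ∀ F, c * ‖F‖ ≤ ‖τ F‖) ∧
      (∀ F, τ F ∈ orbitSpan U a) ∧ ∀ u ∈ orbitSpan U a, ∃ F, τ F = u := by
  obtain ⟨e, T, hT⟩ := ha
  let Φ : Lp ℂ 2 (haarAddCircle (T := (1 : ℝ))) ≃ₗᵢ[ℂ] orbitSpan U a :=
    (fourierBasis (T := (1 : ℝ))).repr.trans e.repr.symm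
  have hΦ : ∀ n : ℤ, Φ (fourierLp 2 n) = e n := fun n => by
    rw [← coe_fourierBasis]
    simp only [Φ, LinearIsometryEquiv.trans_apply, HilbertBasis.repr_self]
    exact e.repr_symm_single n
  let S : orbitSpan U a ≃L[ℂ] orbitSpan U a := T
  let τ : Lp ℂ 2 (haarAddCircle (T := (1 : ℝ))) →L[ℂ] H :=
    (orbitSpan U a).subtypeL ∘L (S : orbitSpan U a →L[ℂ] orbitSpan U a) ∘L
      (Φ.toContinuousLinearEquiv : _ →L[ℂ] orbitSpan U a)
  have hτ : ∀ F, τ F = S (Φ F) := fun _ => rfl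
  refine ⟨τ, fun n => ?_, ⟨(‖(S.symm : orbitSpan U a →L[ℂ] orbitSpan U a)‖ + 1)⁻¹, by positivity,
    fun F => ?_⟩, fun F => ?_, fun u hu => ?_⟩
  · rw [hτ, hΦ]
    exact congrArg Subtype.val (hT n)
  · rw [inv_mul_le_iff₀ (by positivity), hτ]
    have h1 := (S.symm : orbitSpan U a →L[ℂ] orbitSpan U a).le_opNorm (S (Φ F))
    have h2 : (S.symm : orbitSpan U a →L[ℂ] orbitSpan U a) (S (Φ F)) = Φ F :=
      S.symm_apply_apply _
    rw [h2, Φ.norm_map] at h1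
    refine h1.trans ?_
    rw [Submodule.coe_norm]
    gcongr
    linarith
  · exact (S (Φ F)).2
  · refine ⟨Φ.symm (S.symm ⟨u, hu⟩), ?_⟩
    rw [hτ, Φ.apply_symm_apply, S.apply_symm_apply]

theorem norm_sq_eq_integral (F : Lp ℂ 2 (haarAddCircle (T := (1 : ℝ)))) :
    ‖F‖ ^ 2 = ∫ t, ‖F t‖ ^ 2 ∂haarAddCircle := by
  have h1 := L2.inner_def (𝕜 := ℂ) F F
  simp only [inner_self_eq_norm_sq_to_K] at h1
  have h2 : ((‖F‖ ^ 2 : ℝ) : ℂ) = ((∫ t, ‖F t‖ ^ 2 ∂haarAddCircle : ℝ) : ℂ) := by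
    push_cast
    rw [← integral_complex_ofReal]
    push_cast
    exact h1
  exact_mod_cast h2

theorem IsRieszSequence.ne_zero (ha : IsRieszSequence fun n : ℤ => unitaryPow U n a) : a ≠ 0 := by
  obtain ⟨τ, hτ, ⟨c, hc, hcτ⟩, -, -⟩ := exists_fourier_synthesis ha
  rintro rfl
  have h1 := hcτ (fourierLp 2 0)
  rw [hτ, orthonormal_fourier.1, map_zero, norm_zero] at h1
  linarith

variable [CompleteSpace H]

theorem fourierCoeff_symbol (ha : IsRieszSequence fun n : ℤ => unitaryPow U n a) (h : H) (k : ℤ) :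
    fourierCoeff (symbol U a h) k = inner ℂ (unitaryPow U k h) a := by
  rw [← fourierBasis_repr, HilbertBasis.repr_apply_apply, coe_fourierBasis]
  have h1 := (hasSum_symbol U a h ha).mapL (innerSL ℂ (fourierLp 2 k))
  refine h1.unique ?_
  have h2 := hasSum_ite_eq k (inner ℂ (unitaryPow U k h) a : ℂ)
  refine h2.congr_fun fun n => ?_
  rw [innerSL_apply_apply, inner_smul_right, orthonormal_iff_ite.1 orthonormal_fourier k n]
  by_cases hn : n = k
  · simp [hn]
  · simp [hn, Ne.symm hn]

/-- Both sides are continuous in F: the right one is the inner product with conj(g)e_m, which is in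
L² because g is bounded. On an exponential e_k both reduce to the Fourier coefficient of g at m − k.
-/
theorem inner_synthesis_eq_fourierCoeff (ha : IsRieszSequence fun n : ℤ => unitaryPow U n a)
    {τ : Lp ℂ 2 (haarAddCircle (T := (1 : ℝ))) →L[ℂ] H}
    (hτ : ∀ n : ℤ, τ (fourierLp 2 n) = unitaryPow U n a) {h : H}
    (hg : MemLp (symbol U a h) ∞ haarAddCircle) (m : ℤ)
    (F : Lp ℂ 2 (haarAddCircle (T := (1 : ℝ)))) :
    (inner ℂ (unitaryPow U m h) (τ F) : ℂ) = fourierCoeff (fun t => symbol U a h t * F t) m := by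
  have hw : MemLp (fun t => star (symbol U a h t) * fourier m t) 2
      (haarAddCircle (T := (1 : ℝ))) :=
    MemLp.mul (p := ∞) (q := 2) ((fourier m).continuous.memLp_of_hasCompactSupport
      (HasCompactSupport.of_compactSpace _)) hg.star
  have h1 : ∀ F : Lp ℂ 2 (haarAddCircle (T := (1 : ℝ))),
      (inner ℂ (hw.toLp _) F : ℂ) = fourierCoeff (fun t => symbol U a h t * F t) m := fun F => by
    rw [L2.inner_def, fourierCoeff]
    refine integral_congr_ae ?_
    filter_upwards [hw.coeFn_toLp] with t ht
    rw [ht, RCLike.inner_apply, fourier_neg]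
    simp only [map_mul, smul_eq_mul, RCLike.star_def, Complex.conj_conj]
    ring
  rw [← h1]
  have h2 : F ∈ closedSpan (fourierLp (T := (1 : ℝ)) 2) := by
    have := span_fourierLp_closure_eq_top (T := (1 : ℝ)) (p := 2) (by norm_num)
    rw [closedSpan, this]
    trivial
  refine eq_of_mem_closedSpan (L := innerSL ℂ (unitaryPow U m h) ∘L τ)
    (M := innerSL ℂ (hw.toLp _)) (fun k => ?_) h2
  simp only [ContinuousLinearMap.comp_apply, innerSL_apply_apply]
  rw [hτ, inner_unitaryPow_sub, ← fourierCoeff_symbol ha, h1, fourierCoeff, fourierCoeff]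
  refine integral_congr_ae ?_
  filter_upwards [coeFn_fourierLp (T := (1 : ℝ)) 2 k] with t ht
  rw [ht, neg_sub, sub_eq_add_neg, fourier_add, smul_eq_mul, smul_eq_mul]
  ring

theorem hasSum_prod_of_fintype {κ ι : Type*} [Fintype κ] {f : κ × ι → ℝ} (hf : ∀ p, 0 ≤ f p)
    {a : κ → ℝ} (h : ∀ j, HasSum (fun n => f (j, n)) (a j)) : HasSum f (∑ j, a j) := by
  have h1 : Summable f := (summable_prod_of_nonneg hf).2 ⟨fun j => (h j).summable, .of_finite⟩
  have h2 := h1.hasSum.prod_fiberwise h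
  rw [← h2.unique (hasSum_fintype a)]
  exact h1.hasSum

variable {s r : ℕ} {h : Fin s → H}

theorem hasSum_sq_samples (ha : IsRieszSequence fun n : ℤ => unitaryPow U n a) (hr : 0 < r)
    {τ : Lp ℂ 2 (haarAddCircle (T := (1 : ℝ))) →L[ℂ] H}
    (hτ : ∀ n : ℤ, τ (fourierLp 2 n) = unitaryPow U n a)
    (hg : ∀ j, MemLp (symbol U a (h j)) ∞ haarAddCircle)
    (F : Lp ℂ 2 (haarAddCircle (T := (1 : ℝ)))) :
    HasSum (fun p : Fin s × ℤ => ‖inner ℂ (unitaryPow U (r * p.2) (h p.1)) (τ F)‖ ^ 2)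
      (∑ j, (r : ℝ)⁻¹ ^ 2 * ∫ t, ‖periodize r (fun t => symbol U a (h j) t * F t) t‖ ^ 2
        ∂haarAddCircle) := by
  refine hasSum_prod_of_fintype (fun _ => sq_nonneg _) fun j => ?_
  simp only [inner_synthesis_eq_fourierCoeff ha hτ (hg j)]
  exact hasSum_sq_fourierCoeff_mul hr ((Lp.memLp F).mul (hg j))

/-- The samples at multiples of r carry at most the energy ∑ⱼ ‖g_j F‖², which the sup bounds of the
g_j control; the lower bound c of the synthesis map replaces ‖F‖ by ‖u‖. -/
theorem samples_bound (ha : IsRieszSequence fun n : ℤ => unitaryPow U n a) (hr : 0 < r)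
    (hg : ∀ j, MemLp (symbol U a (h j)) ∞ haarAddCircle) :
    ∃ B : ℝ, 0 ≤ B ∧ ∀ u ∈ orbitSpan U a,
      Summable (fun p : Fin s × ℤ => ‖inner ℂ (unitaryPow U (r * p.2) (h p.1)) u‖ ^ 2) ∧
      ∑' p : Fin s × ℤ, ‖inner ℂ (unitaryPow U (r * p.2) (h p.1)) u‖ ^ 2 ≤ B * ‖u‖ ^ 2 := by
  obtain ⟨τ, hτ, ⟨c, hc, hcτ⟩, -, hsur⟩ := exists_fourier_synthesis ha
  choose C hC using fun j => exists_norm_le_of_memLp_top (hg j)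
  refine ⟨(∑ j, C j ^ 2) * c⁻¹ ^ 2, by positivity, fun u hu => ?_⟩
  obtain ⟨F, rfl⟩ := hsur u hu
  have h0 := hasSum_sq_samples ha hr hτ hg F
  refine ⟨h0.summable, h0.tsum_eq.trans_le ?_⟩
  have hF : ‖F‖ ^ 2 ≤ c⁻¹ ^ 2 * ‖τ F‖ ^ 2 := by
    rw [← mul_pow]
    gcongr
    rw [le_inv_mul_iff₀ hc]
    exact hcτ F
  refine le_trans ?_ ((mul_le_mul_of_nonneg_left hF (by positivity)).trans_eq
    (mul_assoc (∑ j, C j ^ 2) _ _).symm)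
  rw [Finset.sum_mul]
  refine Finset.sum_le_sum fun j _ => ?_
  have hm : MemLp (fun t => symbol U a (h j) t * F t) 2 haarAddCircle := (Lp.memLp F).mul (hg j)
  refine (integral_periodize_sq_le hr hm).trans ?_
  rw [norm_sq_eq_integral, ← integral_const_mul]
  refine integral_mono_ae (hm.integrable_norm_pow (by norm_num))
    (((Lp.memLp F).integrable_norm_pow (by norm_num)).const_mul _) ?_
  filter_upwards [hC j] with t ht
  simp only [norm_mul, mul_pow]
  gcongr

/-- The integral criterion is transported along the synthesis map, whose two-sided bounds and the
factor r⁻² from Parseval only change the constant. -/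
theorem alphaG_pos_iff_samples (ha : IsRieszSequence fun n : ℤ => unitaryPow U n a) (hr : 0 < r)
    (hg : ∀ j, MemLp (symbol U a (h j)) ∞ haarAddCircle) :
    0 < alphaG r (fun j => symbol U a (h j)) ↔ ∃ A : ℝ, 0 < A ∧ ∀ u ∈ orbitSpan U a,
      A * ‖u‖ ^ 2 ≤
        ∑' p : Fin s × ℤ, ‖inner ℂ (unitaryPow U (r * p.2) (h p.1)) u‖ ^ 2 := by
  obtain ⟨τ, hτ, ⟨c, hc, hcτ⟩, hmem, hsur⟩ := exists_fourier_synthesis ha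
  have hr0 : (0 : ℝ) < r := by exact_mod_cast hr
  rw [alphaG_pos_iff_integral hr (fun j => (Lp.stronglyMeasurable _).measurable) hg]
  constructor
  · rintro ⟨A, hA, hlow⟩
    refine ⟨(r : ℝ)⁻¹ ^ 2 * A * (‖τ‖ + 1)⁻¹ ^ 2, by positivity, fun u hu => ?_⟩
    obtain ⟨F, rfl⟩ := hsur u hu
    rw [(hasSum_sq_samples ha hr hτ hg F).tsum_eq, ← Finset.mul_sum, mul_assoc, mul_assoc]
    gcongr
    refine le_trans ?_ (hlow F (Lp.memLp F))
    rw [← norm_sq_eq_integral]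
    gcongr
    rw [← mul_pow]
    gcongr
    rw [inv_mul_le_iff₀ (by positivity)]
    refine (τ.le_opNorm F).trans ?_
    gcongr
    linarith
  · rintro ⟨A, hA, hlow⟩
    refine ⟨r ^ 2 * (A * c ^ 2), by positivity, fun F hF => ?_⟩
    have h1 := hlow _ (hmem (hF.toLp F))
    rw [(hasSum_sq_samples ha hr hτ hg _).tsum_eq, ← Finset.mul_sum] at h1
    have h2 : A * c ^ 2 * ‖hF.toLp F‖ ^ 2 ≤ A * ‖τ (hF.toLp F)‖ ^ 2 := by
      rw [mul_assoc, ← mul_pow]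
      gcongr
      exact hcτ _
    rw [norm_sq_eq_integral] at h2
    have h3 : ∫ t, ‖hF.toLp F t‖ ^ 2 ∂haarAddCircle = ∫ t, ‖F t‖ ^ 2 ∂haarAddCircle := by
      refine integral_congr_ae ?_
      filter_upwards [hF.coeFn_toLp] with t ht
      rw [ht]
    have h4 : ∀ j, ∫ t, ‖periodize r (fun t => symbol U a (h j) t * hF.toLp F t) t‖ ^ 2
        ∂haarAddCircle = ∫ t, ‖periodize r (fun t => symbol U a (h j) t * F t) t‖ ^ 2
        ∂haarAddCircle := fun j => by
      refine integral_congr_ae ?_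
      have h5 : ∀ᵐ t ∂(haarAddCircle : Measure UnitAddCircle), ∀ k : ℕ,
          hF.toLp F (t + ((k / r : ℝ) : UnitAddCircle)) =
            F (t + ((k / r : ℝ) : UnitAddCircle)) :=
        ae_all_iff.2 fun k => ae_translate hF.coeFn_toLp _
      filter_upwards [h5] with t ht
      simp only [periodize, ht]
    simp only [h3] at h2
    simp only [h4] at h1
    have h5 := h2.trans h1
    rw [inv_pow, ← div_eq_inv_mul, le_div_iff₀ (by positivity)] at h5
    linarith

/-- The dual system of a stable sampling system. -/
theorem exists_dual_samples (ha : IsRieszSequence fun n : ℤ => unitaryPow U n a) (hr : 0 < r)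
    (hg : ∀ j, MemLp (symbol U a (h j)) ∞ haarAddCircle)
    (hα : 0 < alphaG r (fun j => symbol U a (h j))) :
    ∃ (c : Fin s → H) (z : Fin s × ℤ → H), (∀ j, c j ∈ orbitSpan U a) ∧ IsBessel z ∧
      IsBessel (fun p : Fin s × ℤ => unitaryPow U (r * p.2) (c p.1)) ∧
      ∀ u ∈ orbitSpan U a,
        (∀ p, (inner ℂ (z p) u : ℂ) = inner ℂ (unitaryPow U (r * p.2) (h p.1)) u) ∧
        HasSum (fun p => (inner ℂ (z p) u : ℂ) • unitaryPow U (r * p.2) (c p.1)) u := by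
  obtain ⟨B, hB, hbound⟩ := samples_bound ha hr hg
  obtain ⟨A, hA, hlow⟩ := (alphaG_pos_iff_samples ha hr hg).1 hα
  have : CompleteSpace (orbitSpan U a) := (isClosed_closedSpan _).completeSpace_coe
  set P := (orbitSpan U a).starProjection
  have hPK : ∀ f, P f ∈ orbitSpan U a := (orbitSpan U a).starProjection_apply_mem
  have hPs : ∀ f ∈ orbitSpan U a, P f = f := fun f hf => Submodule.starProjection_eq_self_iff.2 hf
  -- The h_j need not lie in the orbit span; projecting leaves the samples of its elements
  -- unchanged.
  set z : Fin s × ℤ → H := fun p => P (unitaryPow U (r * p.2) (h p.1)) with hz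
  have hzin : ∀ p f, (inner ℂ (z p) f : ℂ) = inner ℂ (unitaryPow U (r * p.2) (h p.1)) (P f) :=
    fun p f => Submodule.inner_starProjection_left_eq_right _ _ _
  have hzin' : ∀ p, ∀ f ∈ orbitSpan U a,
      (inner ℂ (z p) f : ℂ) = inner ℂ (unitaryPow U (r * p.2) (h p.1)) f :=
    fun p f hf => by rw [hzin, hPs f hf]
  have hzB : IsBessel z := isBessel_of_bound (B := B) fun f => by
    simp only [hzin]
    refine ⟨(hbound _ (hPK f)).1, (hbound _ (hPK f)).2.trans ?_⟩
    gcongr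
    exact Submodule.norm_starProjection_apply_le _ f
  have hmem : ∀ (n : ℤ) x, (U ^ n) x ∈ orbitSpan U a ↔ x ∈ orbitSpan U a := fun n x =>
    unitaryPow_mem_orbitSpan_iff U a n x
  have hPU : ∀ (n : ℤ) x, P ((U ^ n) x) = (U ^ n) (P x) := fun n x =>
    starProjection_comm (hmem n) x
  obtain ⟨R, hRK, hRsum, hRW⟩ := exists_dual (K := orbitSpan U a) (z := z) (fun p => hPK _) hzB hA
    fun f hf => by simpa only [hzin' _ f hf] using hlow f hf
  -- U^{rn} maps the frame to itself by the shift (j, m) ↦ (j, n + m), so R commutes with it. The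
  -- dual is therefore the orbit of the vectors R(P h_j).
  have hc : ∀ p : Fin s × ℤ, unitaryPow U (r * p.2) (R (P (h p.1))) = R (z p) := fun p => by
    have h1 := hRW (U ^ ((r : ℤ) * p.2))
      ((Equiv.refl (Fin s)).prodCongr (Equiv.addLeft p.2)) (hmem _) (fun q => by
        simp only [hz]
        rw [← hPU, ← unitaryPow_apply, ← unitaryPow_add, ← mul_add]
        rfl) (P (h p.1))
    rw [← hPU] at h1
    exact h1.symm
  refine ⟨fun j => R (P (h j)), z, fun j => hRK _ (hPK _), hzB, ?_, fun u hu =>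
    ⟨fun p => hzin' p u hu, ?_⟩⟩
  · simp only [hc]
    exact hzB.map R
  · simp only [hc]
    exact hRsum u hu

end Sampling

/-! ### Passage between the factors and the tensor product -/

section TensorSampling

variable {H₁ H₂ : Type*} [NormedAddCommGroup H₁] [InnerProductSpace ℂ H₁]
  [NormedAddCommGroup H₂] [InnerProductSpace ℂ H₂]

/-- Reconstruction formulas in the factors give one in the tensor product. -/
theorem hasSum_tensor_reconstruction {κ₁ κ₂ ι₁ ι₂ : Type*} {a : κ₁ → H₁} {b : κ₂ → H₂}
    {z₁ y₁ : ι₁ → H₁} {z₂ y₂ : ι₂ → H₂} (hz₁ : IsBessel z₁) (hz₂ : IsBessel z₂)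
    (hy₁ : IsBessel y₁) (hy₂ : IsBessel y₂)
    (h₁ : ∀ k, HasSum (fun i => (inner ℂ (z₁ i) (a k) : ℂ) • y₁ i) (a k))
    (h₂ : ∀ k, HasSum (fun i => (inner ℂ (z₂ i) (b k) : ℂ) • y₂ i) (b k))
    {x : HTensor H₁ H₂} (hx : x ∈ closedSpan fun k : κ₁ × κ₂ => tmul (a k.1) (b k.2)) :
    HasSum (fun p : ι₁ × ι₂ => (inner ℂ (tmul (z₁ p.1) (z₂ p.2)) x : ℂ) •
      tmul (y₁ p.1) (y₂ p.2)) x := by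
  obtain ⟨Z, hZ⟩ := hz₁.tmul hz₂
  obtain ⟨Y, hY⟩ := hy₁.tmul hy₂
  have hsum : ∀ w, HasSum (fun p : ι₁ × ι₂ => (inner ℂ (tmul (z₁ p.1) (z₂ p.2)) w : ℂ) •
      tmul (y₁ p.1) (y₂ p.2)) (Y (ContinuousLinearMap.adjoint Z w)) := fun w => by
    have h := hasSum_synthesis hY (ContinuousLinearMap.adjoint Z w)
    simpa only [adjoint_synthesis_apply hZ] using h
  have hid := eq_of_mem_closedSpan (L := Y ∘L ContinuousLinearMap.adjoint Z)
    (M := ContinuousLinearMap.id ℂ (HTensor H₁ H₂)) (fun k => ?_) hx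
  · have h := hsum x
    rwa [show Y (ContinuousLinearMap.adjoint Z x) = x from hid] at h
  · have h := hsum (tmul (a k.1) (b k.2))
    -- On an elementary tensor the double sum can be evaluated iteratively, first over the second
    -- factor and then over the first; uniqueness of sums identifies it with the tensor itself.
    have h3 := h.prod_fiberwise (g := fun i => (inner ℂ (z₁ i) (a k.1) : ℂ) •
      tmul (y₁ i) (b k.2)) fun i => by
        have h4 := ((h₂ k.2).mapL (tmulLeft (y₁ i))).const_smul (inner ℂ (z₁ i) (a k.1) : ℂ)
        simpa only [map_smul, tmulLeft_apply, inner_tmul, smul_smul] using h4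
    have h5 := (h₁ k.1).mapL (tmulRight (b k.2))
    simp only [map_smul, tmulRight_apply] at h5
    exact h3.unique h5

/-- The reindexing of the samples in the tensor product by the samples in the factors. -/
def sampleEquiv (s s' : ℕ) : Fin s × Fin s' × ℤ × ℤ ≃ (Fin s × ℤ) × (Fin s' × ℤ) where
  toFun p := ((p.1, p.2.2.1), (p.2.1, p.2.2.2))
  invFun q := (q.1.1, q.2.1, q.1.2, q.2.2)
  left_inv _ := rfl
  right_inv _ := rfl

theorem tmul_mem_generatedSpace {U : H₁ ≃ₗᵢ[ℂ] H₁} {V : H₂ ≃ₗᵢ[ℂ] H₂} {a u : H₁} {b v : H₂}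
    (hu : u ∈ orbitSpan U a) (hv : v ∈ orbitSpan V b) : tmul u v ∈ generatedSpace U V a b :=
  tmul_mem_closedSpan (x := fun n : ℤ => unitaryPow U n a)
    (y := fun m : ℤ => unitaryPow V m b) hu hv

variable [CompleteSpace H₁] [CompleteSpace H₂] {U : H₁ ≃ₗᵢ[ℂ] H₁} {V : H₂ ≃ₗᵢ[ℂ] H₂}
  {a : H₁} {b : H₂} {s s' r r' : ℕ} {h₁ : Fin s → H₁} {h₂ : Fin s' → H₂}

theorem exists_product_frame (ha : IsRieszSequence fun n : ℤ => unitaryPow U n a)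
    (hb : IsRieszSequence fun m : ℤ => unitaryPow V m b) (hr : 0 < r) (hr' : 0 < r')
    (hg₁ : ∀ j, MemLp (symbol U a (h₁ j)) ∞ haarAddCircle)
    (hg₂ : ∀ j, MemLp (symbol V b (h₂ j)) ∞ haarAddCircle)
    (hα₁ : 0 < alphaG r fun j => symbol U a (h₁ j))
    (hα₂ : 0 < alphaG r' fun j => symbol V b (h₂ j)) :
    ∃ (c : Fin s → H₁) (d : Fin s' → H₂),
      (∀ j j', tmul (c j) (d j') ∈ generatedSpace U V a b) ∧
      IsFrameFor (generatedSpace U V a b)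
        (fun p : Fin s × Fin s' × ℤ × ℤ =>
          opTensor (unitaryPow U (r * p.2.2.1)) (unitaryPow V (r' * p.2.2.2))
            (tmul (c p.1) (d p.2.1))) ∧
      ∀ x ∈ generatedSpace U V a b,
        HasSum
          (fun p : Fin s × Fin s' × ℤ × ℤ =>
            sample U V (h₁ p.1) (h₂ p.2.1) x (r * p.2.2.1) (r' * p.2.2.2) •
              opTensor (unitaryPow U (r * p.2.2.1)) (unitaryPow V (r' * p.2.2.2))
                (tmul (c p.1) (d p.2.1))) x := by
  obtain ⟨c, z₁, hcK, hz₁, hy₁, hrec₁⟩ := exists_dual_samples ha hr hg₁ hα₁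
  obtain ⟨d, z₂, hdK, hz₂, hy₂, hrec₂⟩ := exists_dual_samples hb hr' hg₂ hα₂
  have hrec : ∀ x ∈ generatedSpace U V a b, HasSum (fun p : (Fin s × ℤ) × (Fin s' × ℤ) =>
      (inner ℂ (tmul (z₁ p.1) (z₂ p.2)) x : ℂ) •
        tmul (unitaryPow U (r * p.1.2) (c p.1.1)) (unitaryPow V (r' * p.2.2) (d p.2.1))) x :=
    fun x hx => hasSum_tensor_reconstruction hz₁ hz₂ hy₁ hy₂
      (fun n => (hrec₁ _ (mem_closedSpan (fun n : ℤ => unitaryPow U n a) n)).2)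
      (fun m => (hrec₂ _ (mem_closedSpan (fun m : ℤ => unitaryPow V m b) m)).2) hx
  -- The tensors of the z's need not be the sampling vectors themselves, but they give the same
  -- functional on the generators and hence on their closed span.
  have hsample : ∀ p : (Fin s × ℤ) × (Fin s' × ℤ), ∀ x ∈ generatedSpace U V a b,
      (inner ℂ (tmul (z₁ p.1) (z₂ p.2)) x : ℂ) =
        sample U V (h₁ p.1.1) (h₂ p.2.1) x (r * p.1.2) (r' * p.2.2) := fun p x hx => by
    refine eq_of_mem_closedSpan (L := innerSL ℂ (tmul (z₁ p.1) (z₂ p.2)))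
      (M := innerSL ℂ (tmul (unitaryPow U (r * p.1.2) (h₁ p.1.1))
        (unitaryPow V (r' * p.2.2) (h₂ p.2.1)))) (fun k => ?_) hx
    simp only [innerSL_apply_apply, inner_tmul]
    rw [(hrec₁ _ (mem_closedSpan (fun n : ℤ => unitaryPow U n a) k.1)).1,
      (hrec₂ _ (mem_closedSpan (fun m : ℤ => unitaryPow V m b) k.2)).1]
  have hmem : ∀ p : (Fin s × ℤ) × (Fin s' × ℤ), tmul (unitaryPow U (r * p.1.2) (c p.1.1))
      (unitaryPow V (r' * p.2.2) (d p.2.1)) ∈ generatedSpace U V a b := fun p =>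
    tmul_mem_generatedSpace ((unitaryPow_mem_orbitSpan_iff U a _ _).2 (hcK _))
      ((unitaryPow_mem_orbitSpan_iff V b _ _).2 (hdK _))
  have hframe := isFrameFor_of_reconstruction hmem (hy₁.tmul hy₂) (hz₁.tmul hz₂) hrec
  refine ⟨c, d, fun j j' => tmul_mem_generatedSpace (hcK j) (hdK j'), ?_, fun x hx => ?_⟩
  · simp only [opTensor_tmul]
    exact hframe.reindex (sampleEquiv s s')
  · simp only [opTensor_tmul]
    have h := (sampleEquiv s s').hasSum_iff.2 (hrec x hx)
    rw [show (fun p : Fin s × Fin s' × ℤ × ℤ =>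
        sample U V (h₁ p.1) (h₂ p.2.1) x (r * p.2.2.1) (r' * p.2.2.2) •
          tmul (unitaryPow U (r * p.2.2.1) (c p.1)) (unitaryPow V (r' * p.2.2.2) (d p.2.1))) = _ from
      funext fun p => congrArg (· • tmul (unitaryPow U (r * p.2.2.1) (c p.1))
        (unitaryPow V (r' * p.2.2.2) (d p.2.1))) (hsample (sampleEquiv s s' p) x hx).symm]
    exact h

/-- A lower bound for the samples in the tensor product gives lower bounds in the factors. -/
theorem alphaG_pos_of_frame (ha : IsRieszSequence fun n : ℤ => unitaryPow U n a)
    (hb : IsRieszSequence fun m : ℤ => unitaryPow V m b) (hr : 0 < r) (hr' : 0 < r')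
    (hg₁ : ∀ j, MemLp (symbol U a (h₁ j)) ∞ haarAddCircle)
    (hg₂ : ∀ j, MemLp (symbol V b (h₂ j)) ∞ haarAddCircle)
    {C : Fin s × Fin s' × ℤ × ℤ → HTensor H₁ H₂} (hC : IsFrameFor (generatedSpace U V a b) C)
    (hrec : ∀ x ∈ generatedSpace U V a b, HasSum
      (fun p : Fin s × Fin s' × ℤ × ℤ =>
        sample U V (h₁ p.1) (h₂ p.2.1) x (r * p.2.2.1) (r' * p.2.2.2) • C p) x) :
    0 < alphaG r (fun j => symbol U a (h₁ j)) ∧ 0 < alphaG r' (fun j => symbol V b (h₂ j)) := by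
  obtain ⟨B, hB, hCB⟩ := norm_sq_le_of_frame hC
  obtain ⟨B₁, hB₁, hS₁⟩ := samples_bound ha hr hg₁
  obtain ⟨B₂, hB₂, hS₂⟩ := samples_bound hb hr' hg₂
  -- On u ⊗ v the samples are products, so their square sum factors.
  have hprod : ∀ u ∈ orbitSpan U a, ∀ v ∈ orbitSpan V b, ‖u‖ ^ 2 * ‖v‖ ^ 2 ≤
      B * ((∑' p : Fin s × ℤ, ‖inner ℂ (unitaryPow U (r * p.2) (h₁ p.1)) u‖ ^ 2) *
        ∑' p : Fin s' × ℤ, ‖inner ℂ (unitaryPow V (r' * p.2) (h₂ p.1)) v‖ ^ 2) := by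
    intro u hu v hv
    have hx : tmul u v ∈ generatedSpace U V a b := tmul_mem_generatedSpace hu hv
    have h1 := (hS₁ u hu).1
    have h2 := (hS₂ v hv).1
    have h3 := h1.mul_of_nonneg h2 (fun _ => by positivity) fun _ => by positivity
    have h4 := h1.hasSum.mul h2.hasSum h3
    have h5 : HasSum (fun p : Fin s × Fin s' × ℤ × ℤ =>
        ‖sample U V (h₁ p.1) (h₂ p.2.1) (tmul u v) (r * p.2.2.1) (r' * p.2.2.2)‖ ^ 2)
        ((∑' p : Fin s × ℤ, ‖inner ℂ (unitaryPow U (r * p.2) (h₁ p.1)) u‖ ^ 2) *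
          ∑' p : Fin s' × ℤ, ‖inner ℂ (unitaryPow V (r' * p.2) (h₂ p.1)) v‖ ^ 2) := by
      simp only [sample, inner_tmul, norm_mul, mul_pow]
      exact (sampleEquiv s s').hasSum_iff.2 h4
    have h6 := hCB _ hx _ h5.summable (hrec _ hx)
    rwa [h5.tsum_eq, norm_tmul, mul_pow] at h6
  have hap : 0 < ‖a‖ ^ 2 := by have := norm_pos_iff.2 ha.ne_zero; positivity
  have hbp : 0 < ‖b‖ ^ 2 := by have := norm_pos_iff.2 hb.ne_zero; positivity
  have haK : a ∈ orbitSpan U a := by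
    have h := mem_closedSpan (fun n : ℤ => unitaryPow U n a) 0
    rwa [unitaryPow_zero] at h
  have hbK : b ∈ orbitSpan V b := by
    have h := mem_closedSpan (fun n : ℤ => unitaryPow V n b) 0
    rwa [unitaryPow_zero] at h
  constructor
  · rw [alphaG_pos_iff_samples ha hr hg₁]
    -- Take v = b, whose samples have square sum at most B₂‖b‖². The added 1 keeps the denominator
    -- positive, since B₂ may vanish.
    refine ⟨‖b‖ ^ 2 / (B * (B₂ * ‖b‖ ^ 2 + 1)), by positivity, fun u hu => ?_⟩
    rw [div_mul_eq_mul_div, div_le_iff₀ (by positivity), mul_comm]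
    refine (hprod u hu b hbK).trans ?_
    rw [mul_left_comm]
    have h0 : 0 ≤ ∑' p : Fin s × ℤ, ‖inner ℂ (unitaryPow U (r * p.2) (h₁ p.1)) u‖ ^ 2 :=
      tsum_nonneg fun _ => sq_nonneg _
    gcongr
    linarith [(hS₂ b hbK).2]
  · rw [alphaG_pos_iff_samples hb hr' hg₂]
    refine ⟨‖a‖ ^ 2 / (B * (B₁ * ‖a‖ ^ 2 + 1)), by positivity, fun v hv => ?_⟩
    rw [div_mul_eq_mul_div, div_le_iff₀ (by positivity)]
    refine (hprod a haK v hv).trans ?_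
    rw [mul_comm (∑' p : Fin s × ℤ, _), mul_left_comm]
    have h0 : 0 ≤ ∑' p : Fin s' × ℤ, ‖inner ℂ (unitaryPow V (r' * p.2) (h₂ p.1)) v‖ ^ 2 :=
      tsum_nonneg fun _ => sq_nonneg _
    gcongr
    linarith [(hS₁ a haK).2]

end TensorSampling

end TensorSampling

theorem mainTheorem3
    {H₁ H₂ : Type*}
    [NormedAddCommGroup H₁] [InnerProductSpace ℂ H₁] [CompleteSpace H₁]
    [TopologicalSpace.SeparableSpace H₁]
    [NormedAddCommGroup H₂] [InnerProductSpace ℂ H₂] [CompleteSpace H₂]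
    [TopologicalSpace.SeparableSpace H₂]
    (U : H₁ ≃ₗᵢ[ℂ] H₁) (V : H₂ ≃ₗᵢ[ℂ] H₂) (a : H₁) (b : H₂)
    (ha : IsRieszSequence fun n : ℤ => unitaryPow U n a)
    (hb : IsRieszSequence fun m : ℤ => unitaryPow V m b)
    (s s' r r' : ℕ) (hr : 0 < r) (hr' : 0 < r')
    (h₁ : Fin s → H₁) (h₂ : Fin s' → H₂) :
    ((∀ j, MemLp (symbol U a (h₁ j)) ∞ haarAddCircle) ↔
      betaG r (fun j => symbol U a (h₁ j)) < ∞) ∧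
    ((∀ j', MemLp (symbol V b (h₂ j')) ∞ haarAddCircle) ↔
      betaG r' (fun j' => symbol V b (h₂ j')) < ∞) ∧
    ((∀ j, MemLp (symbol U a (h₁ j)) ∞ haarAddCircle) →
      (∀ j', MemLp (symbol V b (h₂ j')) ∞ haarAddCircle) →
      List.TFAE [
        0 < alphaG r (fun j => symbol U a (h₁ j)) ∧
          0 < alphaG r' (fun j' => symbol V b (h₂ j')),
        ∃ (c : Fin s → H₁) (d : Fin s' → H₂),
          (∀ j j', tmul (c j) (d j') ∈ generatedSpace U V a b) ∧
          IsFrameFor (generatedSpace U V a b)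
            (fun p : Fin s × Fin s' × ℤ × ℤ =>
              opTensor (unitaryPow U (r * p.2.2.1)) (unitaryPow V (r' * p.2.2.2))
                (tmul (c p.1) (d p.2.1))) ∧
          ∀ x ∈ generatedSpace U V a b,
            HasSum
              (fun p : Fin s × Fin s' × ℤ × ℤ =>
                sample U V (h₁ p.1) (h₂ p.2.1) x (r * p.2.2.1) (r' * p.2.2.2) •
                  opTensor (unitaryPow U (r * p.2.2.1)) (unitaryPow V (r' * p.2.2.2))
                    (tmul (c p.1) (d p.2.1))) x,
        ∃ C : Fin s × Fin s' × ℤ × ℤ → HTensor H₁ H₂,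
          IsFrameFor (generatedSpace U V a b) C ∧
          ∀ x ∈ generatedSpace U V a b,
            HasSum
              (fun p : Fin s × Fin s' × ℤ × ℤ =>
                sample U V (h₁ p.1) (h₂ p.2.1) x (r * p.2.2.1) (r' * p.2.2.2) • C p) x]) := by
  refine ⟨memLp_top_iff_betaG_lt_top hr fun j => (Lp.stronglyMeasurable _).aestronglyMeasurable,
    memLp_top_iff_betaG_lt_top hr' fun j => (Lp.stronglyMeasurable _).aestronglyMeasurable,
    fun hg₁ hg₂ => ?_⟩
  tfae_have 1 → 2 := fun h => exists_product_frame ha hb hr hr' hg₁ hg₂ h.1 h.2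
  tfae_have 2 → 3 := fun ⟨_, _, _, hf, hrec⟩ => ⟨_, hf, hrec⟩
  tfae_have 3 → 1 := fun ⟨_, hf, hrec⟩ => alphaG_pos_of_frame ha hb hr hr' hg₁ hg₂ hf hrec
  tfae_finish
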